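/- Let $0<q<1$, $\lambda>0$, $\eta\in\mathbb{R}$, $b=\lambda-i\eta$ and $\eta_q=\eta\ln q$. Write $(a;q)_k=\prod_{i=0}^{k-1}(1-aq^i)$, $(a;q)_\infty=\prod_{i=0}^{\infty}(1-aq^i)$ and $${}_2\phi_1(\alpha,\beta;\gamma;q,z)=\sum_{n\ge 0}\frac{(\alpha;q)_n(\beta;q)_n}{(q;q)_n(\gamma;q)_n}z^n .$$ Let $\check\mu^{(b)}$ be the positive measure on the unit circle given by $$d\check\mu^{(b)}(\zeta)=\rho\,\frac{|(q\zeta;q)_\infty|^2}{|(q^b\zeta;q)_\infty|^2}\,\frac{d\zeta}{2\pi i\zeta},$$ where $\rho>0$ is a constant. For $k\ge 0$ put $$R_k(b;z)=\frac{(q^{\bar b};q)_k}{(q^\lambda\cos\eta_q;q)_k}\;{}_2\phi_1\big(q^{-k},q^b;q^{-\bar b-k+1};q,q^{-\bar b+1}z\big),$$ (a terminating series), and for $k\ge 1$ put $$d_{k+1}^{(b)}=\frac{(1-q^k)(1-q^{2\lambda+k-1})}{4(1-q^{\lambda+k-1}\cos\eta_q)(1-q^{\lambda+k}\cos\eta_q)}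 .$$ A parameter sequence of $\{d_{k+1}^{(b)}\}_{k\ge1}$ is a real sequence $\{g_k\}_{k\ge1}$ with $0\le g_1<1$ and, for $k\ge1$, $0<g_{k+1}<1$ and $d_{k+1}^{(b)}=(1-g_k)g_{k+1}$; it is the maximal one if it dominates every other parameter sequence termwise. **Theorem.** Let $$M_1^{(b)}=\frac12\,\frac{1-q^{\bar b}}{1-q^\lambda\cos\eta_q}\,\frac{1}{{}_2\phi_1(q,q^{-b+1};q^{\bar b+1};q,q^b)},\qquad M_{k+1}^{(b)}=\frac{d_{k+1}^{(b)}}{1-M_k^{(b)}}\quad(k\ge1).$$ These numbers are well defined and real, and $\{M_k^{(b)}\}_{k\ge1}$ is the maximal parameter sequence of $\{d_{k+1}^{(b)}\}_{k\ge1}$. For every $\rho>0$, there is exactly one sequence $\{\check\Phi_k(b;\cdot)\}_{k\ge0}$ of monic orthogonal polynomials on the unit circle with respect to $\check\mu^{(b)}$ ($\deg\check\Phi_k=k$ and $\int\overline{\check\Phi_j}\,\check\Phi_k\,d\check\mu^{(b)}=0$ for $j\ne k$), and $$\check\Phi_k(b;z)=\frac{(q^\lambda\cos\eta_q;q)_k}{(q^b;q)_k}\big[R_k(b;z)-2(1-M_k^{(b)})R_{k-1}(b;z)\big],\qquad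 k\ge1 .$$ The Verblunsky coefficients $\check\alpha_{k-1}^{(b)}=-\overline{\check\Phi_k(b;0)}$ are $$\check\alpha_{k-1}^{(b)}=\Big[1-2M_k^{(b)}\,\frac{1-q^{\lambda+k-1}\cos\eta_q}{1-q^{\bar b+k-1}}\Big]\frac{(q^b;q)_{k-1}}{(q^{\bar b};q)_{k-1}},\qquad k\ge1 .$$ If moreover $\rho$ is such that $\check\mu^{(b)}$ is a probability measure, then the orthonormal polynomials with positive leading coefficients are $\check\kappa_k^{(b)}\check\Phi_k(b;z)$, where $\check\kappa_k^{(b)}>0$ and $$[\check\kappa_k^{(b)}]^{-2}=\frac{(q;q)_k(q^{2\lambda};q)_k}{(q^b;q)_k(q^{\bar b};q)_k}\,\frac{1-q^\lambda\cos\eta_q}{1-q^{\lambda+k}\cos\eta_q}\,\frac{M_1^{(b)}}{M_{k+1}^{(b)}},\qquad k\ge0 .$$ -/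

import Mathlib

open MeasureTheory
open scoped ComplexConjugate Polynomial

noncomputable section

namespace QOPUC

/-- The finite `q`-shifted factorial `(a; q)_n = ∏_{i < n} (1 - a q^i)`. -/
def qPoch (a q : ℂ) (n : ℕ) : ℂ := ∏ i ∈ Finset.range n, (1 - a * q ^ i)

/-- The infinite `q`-shifted factorial `(a; q)_∞ = ∏_{i ≥ 0} (1 - a q^i)`, for `|q| < 1`. -/
def qPochInf (a q : ℂ) : ℂ := ∏' i : ℕ, (1 - a * q ^ i)

/-- The basic hypergeometric series
`₂φ₁(a, b; c; q, z) = ∑_n (a; q)_n (b; q)_n / ((q; q)_n (c; q)_n) z^n`. When `a = q^{-k}`, the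
terms with `n > k` vanish, whatever the value of `(c; q)_n` is, so that the sum is finite. -/
def phi21 (a b c q z : ℂ) : ℂ :=
  ∑' n : ℕ, qPoch a q n * qPoch b q n / (qPoch q q n * qPoch c q n) * z ^ n

/-- The parameter `b = lam - i eta`. -/
def bParam (lam eta : ℝ) : ℂ := (lam : ℂ) - Complex.I * (eta : ℂ)

/-- The real number `q^lam cos(eta_q)`, where `eta_q = eta ln q`. -/
def qcos (q lam eta : ℝ) : ℝ := q ^ lam * Real.cos (eta * Real.log q)

/-- The modified basic hypergeometric polynomial `R_k(b; z)`, where `b = lam - i eta`. -/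
def Rpoly (q lam eta : ℝ) (k : ℕ) (z : ℂ) : ℂ :=
  qPoch ((q : ℂ) ^ conj (bParam lam eta)) q k / qPoch (qcos q lam eta : ℂ) q k *
    phi21 ((q : ℂ) ^ (-(k : ℂ))) ((q : ℂ) ^ bParam lam eta)
      ((q : ℂ) ^ (-conj (bParam lam eta) - (k : ℂ) + 1)) q
      ((q : ℂ) ^ (-conj (bParam lam eta) + 1) * z)

/-- The real number `d_{k+1}`, as a function of `k` (used for `k ≥ 1`):
`(1 - q^k)(1 - q^{2 lam + k - 1}) / (4 (1 - q^{lam+k-1} cos eta_q)(1 - q^{lam+k} cos eta_q))`. -/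
def dNext (q lam eta : ℝ) (k : ℕ) : ℝ :=
  (1 - q ^ k) * (1 - q ^ (2 * lam + (k : ℝ) - 1)) /
    (4 * (1 - q ^ (lam + (k : ℝ) - 1) * Real.cos (eta * Real.log q)) *
      (1 - q ^ (lam + (k : ℝ)) * Real.cos (eta * Real.log q)))

/-- `(g_n)_{n ≥ 0}` is a parameter sequence of the (positive chain) sequence `(a_n)_{n ≥ 1}`:
`0 ≤ g_0 < 1`, and `0 < g_n < 1` and `a_n = (1 - g_{n-1}) g_n` for `n ≥ 1`. -/
def IsParameterSeq (a g : ℕ → ℝ) : Prop :=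
  0 ≤ g 0 ∧ g 0 < 1 ∧
    ∀ n : ℕ, 0 < g (n + 1) ∧ g (n + 1) < 1 ∧ a (n + 1) = (1 - g n) * g (n + 1)

/-- `(M_n)_{n ≥ 0}` is the maximal parameter sequence of `(a_n)_{n ≥ 1}`. -/
def IsMaximalParameterSeq (a M : ℕ → ℝ) : Prop :=
  IsParameterSeq a M ∧ ∀ g : ℕ → ℝ, IsParameterSeq a g → ∀ n : ℕ, g n ≤ M n

instance : MeasurableSpace Circle := borel Circle

instance : BorelSpace Circle := ⟨rfl⟩

/-- Normalised arc length `dζ / (2 π i ζ) = dθ / (2 π)` on the unit circle. -/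
def arcLength : Measure Circle :=
  ENNReal.ofReal (1 / (2 * Real.pi)) •
    Measure.map Circle.exp (volume.restrict (Set.Ioc 0 (2 * Real.pi)))

/-- The weight `|(qζ; q)_∞|² / |(q^b ζ; q)_∞|²` on the unit circle, where `b = lam - i eta`. -/
def weight (q lam eta : ℝ) (ζ : Circle) : ℝ :=
  ‖qPochInf ((q : ℂ) * (ζ : ℂ)) q‖ ^ 2 /
    ‖qPochInf ((q : ℂ) ^ bParam lam eta * (ζ : ℂ)) q‖ ^ 2

/-- The measure `ρ |(qζ; q)_∞|² / |(q^b ζ; q)_∞|² dζ / (2 π i ζ)` on the unit circle. -/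
def muCheck (q lam eta ρ : ℝ) : Measure Circle :=
  arcLength.withDensity fun ζ => ENNReal.ofReal (ρ * weight q lam eta ζ)

/-- The inner product `∫ conj(f(ζ)) g(ζ) dμ(ζ)` of two polynomials on the unit circle. -/
def ip (μ : Measure Circle) (f g : ℂ[X]) : ℂ :=
  ∫ ζ : Circle, conj (f.eval (ζ : ℂ)) * g.eval (ζ : ℂ) ∂μ

/-- `(Φ_k)` is the sequence of monic orthogonal polynomials on the unit circle with respect to
`μ`: `Φ_k` is monic of exact degree `k`, and distinct members are orthogonal. -/
def IsMonicOPUC (μ : Measure Circle) (Φ : ℕ → ℂ[X]) : Prop :=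
  (∀ k, (Φ k).Monic ∧ (Φ k).natDegree = k) ∧ ∀ j k, j ≠ k → ip μ (Φ j) (Φ k) = 0

/-- `(φ_k)` is the sequence of orthonormal polynomials on the unit circle with respect to `μ`,
with positive leading coefficients `(κ_k)`. -/
def IsOrthonormalOPUC (μ : Measure Circle) (κ : ℕ → ℝ) (φ : ℕ → ℂ[X]) : Prop :=
  (∀ k, 0 < κ k ∧ (φ k).natDegree = k ∧ (φ k).leadingCoeff = (κ k : ℂ)) ∧
    ∀ j k, ip μ (φ j) (φ k) = if j = k then 1 else 0

/-- The Verblunsky coefficients `α_k = - conj(Φ_{k+1}(0))`. -/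
def verblunsky (Φ : ℕ → ℂ[X]) (k : ℕ) : ℂ := -conj ((Φ (k + 1)).eval 0)

end QOPUC

end

open QOPUC

/-! Write a = q^b, let c_n be the moments of the measure, and let P_k be `qUltraPoly a (conj a) q
k`, a multiple of R_k (`Rpoly_eq`). Everything rests on P_k being a multiple of the reproducing
kernel at the point 1 for polynomials of degree at most k.

The weight is a function of z times a function of 1/z, each satisfying a first-order q-difference
equation. Moving the contour from |z| = 1 to |z| = q turns these into a first-order recurrence for
the differences c_n - c_{n-1} (`circCoeff_qQuot_recurrence`). Creative telescoping
(`qUltraConv_succ`) then gives ⟨X^j, (1 - X) P_k⟩ = 0 for 1 ≤ j ≤ k, so ⟨X^j, P_k⟩ is a number s_k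
that does not depend on j ≤ k. Hence P_{k+1} - (s_{k+1}/s_k) P_k is orthogonal to all polynomials of
degree at most k. Its norm comes from ⟨X^{k+1}, (1 - X) P_k⟩, the first such product that survives
(`ip_boundary`), and the norm formula gives s_k > 0 by induction.

The three-term recurrence of P_k makes s_k and P_k(1) solutions of the same real linear recurrence.
The ratios s_{k+1}/s_k therefore give a parameter sequence of d (`one_sub_chainParam_mul`). By
linearity, a parameter sequence exceeding it somewhere would keep P_n(1)/s_n bounded
(`isMaximalParameterSeq_of_unbounded`). But this ratio is the kernel on the diagonal at 1, and
testing with 1 + ... + X^n against a bounded weight shows that it grows at least linearly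
(`sq_mul_mass_le`, `exists_ip_geom_sum_le`).

The first parameter depends only on c_0 and c_1 - c_0. Since c_n tends to 0 by Riemann–Lebesgue, the
increments sum to -c_0, and this sum is the nonterminating ₂φ₁ series (`mul_phi21_eq_neg`). -/

noncomputable section

namespace QOPUC

/-! ### The kernel polynomials and creative telescoping. -/

/-- The coefficients `(a; q)_n / (q; q)_n` of the `q`-binomial series. -/
def qBinomCoeff (a q : ℂ) (n : ℕ) : ℂ := qPoch a q n / qPoch q q n

lemma qPoch_zero (a q : ℂ) : qPoch a q 0 = 1 := by simp [qPoch]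

lemma qPoch_succ (a q : ℂ) (n : ℕ) : qPoch a q (n + 1) = qPoch a q n * (1 - a * q ^ n) := by
  simp [qPoch, Finset.prod_range_succ]

lemma qPoch_self_ne_zero {q : ℂ} (hq : ∀ n : ℕ, 1 - q ^ (n + 1) ≠ 0) (n : ℕ) :
    qPoch q q n ≠ 0 := by
  rw [qPoch, Finset.prod_ne_zero_iff]
  intro i _
  simpa [pow_succ'] using hq i

lemma qBinomCoeff_zero (a q : ℂ) : qBinomCoeff a q 0 = 1 := by simp [qBinomCoeff, qPoch_zero]

lemma qBinomCoeff_succ {q : ℂ} (hq : ∀ n : ℕ, 1 - q ^ (n + 1) ≠ 0) (a : ℂ) (n : ℕ) :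
    (1 - q ^ (n + 1)) * qBinomCoeff a q (n + 1) = (1 - a * q ^ n) * qBinomCoeff a q n := by
  have h1 := qPoch_self_ne_zero hq n
  have h2 := hq n
  rw [qBinomCoeff, qBinomCoeff, qPoch_succ, qPoch_succ, ← pow_succ']
  field_simp

/-- The polynomial `∑_{i ≤ k} (a; q)_i (a'; q)_{k-i} / ((q; q)_i (q; q)_{k-i}) X^i`. -/
def qUltraPoly (a a' q : ℂ) (k : ℕ) : ℂ[X] :=
  ∑ i ∈ Finset.range (k + 1),
    Polynomial.C (qBinomCoeff a q i * qBinomCoeff a' q (k - i)) * Polynomial.X ^ i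

lemma qUltraPoly_zero (a a' q : ℂ) : qUltraPoly a a' q 0 = 1 := by
  simp [qUltraPoly, qBinomCoeff_zero]

lemma coeff_qUltraPoly (a a' q : ℂ) (k i : ℕ) :
    (qUltraPoly a a' q k).coeff i =
      if i ≤ k then qBinomCoeff a q i * qBinomCoeff a' q (k - i) else 0 := by
  simp only [qUltraPoly, Polynomial.finsetSum_coeff, Polynomial.coeff_C_mul_X_pow]
  simp

lemma coeff_qUltraPoly_of_add (a a' q : ℂ) (i l : ℕ) :
    (qUltraPoly a a' q (i + l)).coeff i = qBinomCoeff a q i * qBinomCoeff a' q l := by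
  simp [coeff_qUltraPoly]

lemma coeff_qUltraPoly_of_lt (a a' q : ℂ) {k i : ℕ} (h : k < i) :
    (qUltraPoly a a' q k).coeff i = 0 := by
  simp [coeff_qUltraPoly, h]

lemma degree_qUltraPoly_le (a a' q : ℂ) (k : ℕ) : (qUltraPoly a a' q k).degree ≤ k := by
  rw [Polynomial.degree_le_iff_coeff_zero]
  intro m hm
  exact coeff_qUltraPoly_of_lt _ _ _ (by exact_mod_cast hm)

lemma eval_qUltraPoly (a a' q z : ℂ) (k : ℕ) :
    (qUltraPoly a a' q k).eval z =
      ∑ i ∈ Finset.range (k + 1), qBinomCoeff a q i * qBinomCoeff a' q (k - i) * z ^ i := by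
  simp [qUltraPoly, Polynomial.eval_finsetSum]

lemma qUltraPoly_one {q : ℂ} (hq : ∀ n : ℕ, 1 - q ^ (n + 1) ≠ 0) (a a' : ℂ) :
    Polynomial.C (1 - q) * qUltraPoly a a' q 1 =
      Polynomial.C (1 - a) * Polynomial.X + Polynomial.C (1 - a') := by
  have h1 := qBinomCoeff_succ hq a 0
  have h2 := qBinomCoeff_succ hq a' 0
  simp only [zero_add, pow_one, pow_zero, mul_one, qBinomCoeff_zero] at h1 h2
  rw [← h1, ← h2, qUltraPoly]
  simp [Finset.sum_range_succ, qBinomCoeff_zero]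
  ring

/-- The three-term recurrence of the polynomials `qUltraPoly`. -/
lemma qUltraPoly_add_two {q : ℂ} (hq : ∀ n : ℕ, 1 - q ^ (n + 1) ≠ 0) (a a' : ℂ) (k : ℕ) :
    Polynomial.C (1 - q ^ (k + 2)) * qUltraPoly a a' q (k + 2) =
      Polynomial.C (1 - a * q ^ (k + 1)) * (Polynomial.X * qUltraPoly a a' q (k + 1)) +
        Polynomial.C (1 - a' * q ^ (k + 1)) * qUltraPoly a a' q (k + 1) -
        Polynomial.C (1 - a * a' * q ^ k) * (Polynomial.X * qUltraPoly a a' q k) := by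
  ext i
  simp only [Polynomial.coeff_sub, Polynomial.coeff_add, Polynomial.coeff_C_mul]
  rcases i with _ | i
  · have h := qBinomCoeff_succ hq a' (k + 1)
    simp only [Polynomial.coeff_X_mul_zero, coeff_qUltraPoly, zero_le, if_true, Nat.sub_zero,
      qBinomCoeff_zero]
    linear_combination h
  · simp only [Polynomial.coeff_X_mul]
    rcases lt_trichotomy i (k + 1) with h | h | h
    · obtain ⟨l, rfl⟩ : ∃ l, k = i + l := ⟨k - i, by omega⟩
      rw [show i + l + 2 = (i + 1) + (l + 1) by ring, coeff_qUltraPoly_of_add,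
        show i + 1 + (l + 1) = i + l + 2 by ring, coeff_qUltraPoly_of_add,
        show i + l + 1 = i + (l + 1) by ring, coeff_qUltraPoly_of_add,
        show i + (l + 1) = (i + 1) + l by ring, coeff_qUltraPoly_of_add]
      have h1 := qBinomCoeff_succ hq a i
      have h2 := qBinomCoeff_succ hq a' l
      have h3 := hq i
      have h4 := hq l
      rw [mul_comm, ← eq_div_iff h3] at h1
      rw [mul_comm, ← eq_div_iff h4] at h2
      rw [h1, h2]
      field_simp
      ring
    · subst h
      have h := qBinomCoeff_succ hq a (k + 1)
      rw [coeff_qUltraPoly_of_lt a a' q (show k < k + 1 by omega),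
        coeff_qUltraPoly_of_lt a a' q (show k + 1 < k + 1 + 1 by omega)]
      simp only [coeff_qUltraPoly, le_refl, if_true, Nat.sub_self, qBinomCoeff_zero]
      linear_combination h
    · rw [coeff_qUltraPoly_of_lt a a' q (show k < i by omega),
        coeff_qUltraPoly_of_lt a a' q (show k + 1 < i by omega),
        coeff_qUltraPoly_of_lt a a' q (show k + 2 < i + 1 by omega),
        coeff_qUltraPoly_of_lt a a' q (show k + 1 < i + 1 by omega)]
      ring

/-- The convolution of the coefficients of `qUltraPoly a a' q k` with a bilateral sequence. -/
def qUltraConv (a a' q : ℂ) (u : ℤ → ℂ) (k : ℕ) (j : ℤ) : ℂ :=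
  ∑ i ∈ Finset.range (k + 1), qBinomCoeff a q i * qBinomCoeff a' q (k - i) * u (j - i)

/-- A two-term recurrence, obtained by creative telescoping, for the convolution with a
bilateral `q`-hypergeometric sequence. -/
lemma qUltraConv_succ {q : ℂ} (hq0 : q ≠ 0) (hq : ∀ n : ℕ, 1 - q ^ (n + 1) ≠ 0) (a a' : ℂ)
    {u : ℤ → ℂ} (hu : ∀ n : ℤ, (1 - a' * q ^ n) * u (n + 1) = (a - q ^ n) * u n)
    (k : ℕ) (j : ℤ) :
    (1 - a * q ^ ((k : ℤ) + 1 - j)) * (1 - q ^ (k + 1)) * qUltraConv a a' q u (k + 1) j =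
      (1 - q ^ ((k : ℤ) + 1 - j)) * (1 - a * a' * q ^ k) * qUltraConv a a' q u k j := by
  set w : ℂ := q ^ (-j) with hw
  have hw0 : w ≠ 0 := zpow_ne_zero _ hq0
  have hz : ∀ n : ℕ, q ^ ((n : ℤ) + 1 - j) = q ^ n * q * w := by
    intro n
    rw [hw, sub_eq_add_neg, zpow_add₀ hq0, zpow_add₀ hq0, zpow_one, zpow_natCast]
  -- The recurrence of `u` at n = j - (i + 1), multiplied by q^(-n) so that only nonnegative powers
  -- of q times `w` occur.
  have hu' : ∀ i : ℕ, (1 - a * q ^ ((i : ℤ) + 1 - j)) * u (j - (i + 1)) =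
      (a' - q ^ ((i : ℤ) + 1 - j)) * u (j - i) := by
    intro i
    have h := hu (j - (i + 1))
    rw [show j - ((i : ℤ) + 1) + 1 = j - i by ring] at h
    have hx : q ^ (j - ((i : ℤ) + 1)) * q ^ ((i : ℤ) + 1 - j) = 1 := by
      rw [← zpow_add₀ hq0]; simp
    linear_combination q ^ ((i : ℤ) + 1 - j) * h +
      (-u (j - (i + 1)) + a' * u (j - i)) * hx
  -- The telescoping certificate: it vanishes at i = 0 through 1 - q^i, and at i = k + 1 it cancels
  -- the one term of the longer sum that the shorter sum lacks.
  let G : ℕ → ℂ := fun i => -q ^ (k + 1 - i) * (1 - q ^ i) * qBinomCoeff a q i *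
    qBinomCoeff a' q (k + 1 - i) * (1 - a * (q ^ i * w)) * u (j - i)
  have htel : ∀ i ∈ Finset.range (k + 1),
      (1 - a * q ^ ((k : ℤ) + 1 - j)) * (1 - q ^ (k + 1)) *
          (qBinomCoeff a q i * qBinomCoeff a' q (k + 1 - i) * u (j - i)) -
        (1 - q ^ ((k : ℤ) + 1 - j)) * (1 - a * a' * q ^ k) *
          (qBinomCoeff a q i * qBinomCoeff a' q (k - i) * u (j - i)) = G (i + 1) - G i := by
    intro i hi
    rw [Finset.mem_range] at hi
    obtain ⟨l, rfl⟩ : ∃ l, k = i + l := ⟨k - i, by omega⟩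
    have h1 := qBinomCoeff_succ hq a i
    have h2 := qBinomCoeff_succ hq a' l
    have h3 := hu' i
    simp only [G]
    rw [show i + l + 1 - i = l + 1 by omega, show i + l - i = l by omega,
      show i + l + 1 - (i + 1) = l by omega, hz]
    rw [hz] at h3
    push_cast
    rw [show q ^ (i + 1) = q ^ i * q by ring] at *
    rw [show q ^ (l + 1) = q ^ l * q by ring] at *
    rw [show q ^ (i + l + 1) = q ^ i * q ^ l * q by ring, show q ^ (i + l) = q ^ i * q ^ l by ring]
    generalize q ^ i = x at *
    generalize q ^ l = y at *
    linear_combination (1 - a * x ^ 2 * y * q * w) * qBinomCoeff a q i * u (j - i) * h2 +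
      y * qBinomCoeff a' q l * (1 - a * q * x * w) * u (j - (i + 1)) * h1 +
      y * qBinomCoeff a' q l * (1 - a * x) * qBinomCoeff a q i * h3
  have hsum := Finset.sum_congr rfl htel
  rw [Finset.sum_range_sub, Finset.sum_sub_distrib, ← Finset.mul_sum, ← Finset.mul_sum] at hsum
  rw [qUltraConv, Finset.sum_range_succ, qUltraConv]
  have hG0 : G 0 = 0 := by simp [G]
  have hG1 : G (k + 1) = -((1 - a * q ^ ((k : ℤ) + 1 - j)) * (1 - q ^ (k + 1)) *
      (qBinomCoeff a q (k + 1) * qBinomCoeff a' q (k + 1 - (k + 1)) * u (j - (k + 1 : ℕ)))) := by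
    simp only [G, hz, Nat.sub_self, pow_zero]
    ring
  rw [hG0, hG1] at hsum
  linear_combination hsum

/-- For index j + 1, the step from k = j has the factor 1 - q^0 on the right, so the convolution
vanishes at k = j + 1. The recurrence carries the zero to all larger k, as the coefficients on its
left never vanish. -/
lemma qUltraConv_eq_zero {q : ℂ} (hq0 : q ≠ 0) (hq : ∀ n : ℕ, 1 - q ^ (n + 1) ≠ 0) {a a' : ℂ}
    (ha : ∀ n : ℕ, 1 - a * q ^ n ≠ 0)
    {u : ℤ → ℂ} (hu : ∀ n : ℤ, (1 - a' * q ^ n) * u (n + 1) = (a - q ^ n) * u n)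
    (j l : ℕ) : qUltraConv a a' q u (j + 1 + l) (j + 1) = 0 := by
  induction l with
  | zero =>
    have h := qUltraConv_succ hq0 hq a a' hu j (j + 1)
    rw [sub_self, zpow_zero, mul_one, sub_self, zero_mul, zero_mul, mul_eq_zero, mul_eq_zero] at h
    have h0 := ha 0
    rw [pow_zero, mul_one] at h0
    simpa only [h0, hq j, or_self, false_or, add_zero] using h
  | succ l ih =>
    have h := qUltraConv_succ hq0 hq a a' hu (j + 1 + l) (j + 1)
    rw [ih, mul_zero, show ((j + 1 + l : ℕ) : ℤ) + 1 - (j + 1) = (l + 1 : ℕ) by push_cast; ring,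
      zpow_natCast, mul_eq_zero, mul_eq_zero] at h
    rw [← add_assoc]
    simpa only [ha (l + 1), hq (j + 1 + l), or_self, false_or] using h

/-! ### The infinite `q`-shifted factorial -/

lemma summable_norm_mul_geometric {q : ℂ} (hq : ‖q‖ < 1) (x : ℂ) :
    Summable fun i : ℕ => ‖-(x * q ^ i)‖ := by
  simp_rw [norm_neg, norm_mul, norm_pow]
  exact (summable_geometric_of_lt_one (norm_nonneg _) hq).mul_left _

lemma qPochInf_eq {q : ℂ} (hq : ‖q‖ < 1) (x : ℂ) :
    qPochInf x q = (1 - x) * qPochInf (q * x) q := by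
  have h1 : Multipliable fun i : ℕ => (1 - q * x * q ^ i) := by
    simpa [sub_eq_add_neg] using multipliable_one_add_of_summable
      (summable_norm_mul_geometric hq (q * x))
  have h2 : (fun i : ℕ => 1 - x * q ^ (i + 1)) = fun i => 1 - q * x * q ^ i := by
    ext i; ring
  rw [qPochInf, tprod_eq_zero_mul' (by rw [h2]; exact h1), qPochInf, h2]
  simp

lemma qPochInf_ne_zero {q : ℂ} (hq : ‖q‖ < 1) {x : ℂ} (hx : ‖x‖ < 1) : qPochInf x q ≠ 0 := by
  have := tprod_one_add_ne_zero_of_summable (f := fun i : ℕ => -(x * q ^ i)) (fun i h => ?_)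
    (summable_norm_mul_geometric hq x)
  · simpa [qPochInf, sub_eq_add_neg] using this
  · have h1 : x * q ^ i = 1 := by linear_combination -h
    have h2 : ‖x * q ^ i‖ < 1 := by
      rw [norm_mul, norm_pow]
      calc ‖x‖ * ‖q‖ ^ i ≤ ‖x‖ * 1 := by
            gcongr
            exact pow_le_one₀ (norm_nonneg _) hq.le
        _ < 1 := by simpa using hx
    simp [h1] at h2

lemma differentiable_qPochInf {q : ℂ} (hq : ‖q‖ < 1) :
    Differentiable ℂ fun x => qPochInf x q := by
  intro x
  have hmem : x ∈ Metric.ball (0 : ℂ) (‖x‖ + 1) := by simp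
  have h : HasProdLocallyUniformlyOn (fun (n : ℕ) (x : ℂ) => 1 + -(x * q ^ n))
      (fun x => ∏' i : ℕ, (1 + -(x * q ^ i))) (Metric.ball (0 : ℂ) (‖x‖ + 1)) := by
    refine Summable.hasProdLocallyUniformlyOn_nat_one_add Metric.isOpen_ball
      ((summable_geometric_of_lt_one (norm_nonneg _) hq).mul_left (‖x‖ + 1))
      (.of_forall fun n y hy => ?_) (fun n => by fun_prop)
    rw [norm_neg, norm_mul, norm_pow]
    gcongr
    simpa using (mem_ball_zero_iff.mp hy).le
  have hd : DifferentiableOn ℂ (fun x => ∏' i : ℕ, (1 + -(x * q ^ i)))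
      (Metric.ball (0 : ℂ) (‖x‖ + 1)) :=
    h.differentiableOn (.of_forall fun _ => by
      simpa [Finset.prod_fn] using DifferentiableOn.finsetProd (fun _ _ => by fun_prop))
      Metric.isOpen_ball
  have := hd.differentiableAt (Metric.isOpen_ball.mem_nhds hmem)
  simpa [qPochInf, sub_eq_add_neg] using this

lemma conj_qPochInf {q : ℝ} (hq0 : 0 < q) (hq1 : q < 1) (x : ℂ) :
    conj (qPochInf x q) = qPochInf (conj x) q := by
  have hq : ‖(q : ℂ)‖ < 1 := by simpa [abs_of_pos hq0] using hq1
  have h1 : Multipliable fun i : ℕ => (1 - x * (q : ℂ) ^ i) := by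
    simpa [sub_eq_add_neg] using multipliable_one_add_of_summable
      (summable_norm_mul_geometric hq x)
  have := h1.map_tprod (starRingEnd ℂ) Complex.continuous_conj
  rw [qPochInf, this]
  simp [qPochInf]

/-- The quotient `(qz; q)_∞ / (az; q)_∞`. -/
def qQuot (a q z : ℂ) : ℂ := qPochInf (q * z) q / qPochInf (a * z) q

/-- Replacing z by qz drops the first factor of each infinite product. Besides analyticity, this is
the only property of the weight behind its moment recurrence. -/
lemma qQuot_eq {q : ℂ} (hq : ‖q‖ < 1) {a z : ℂ} (h : ‖a * z‖ < 1) :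
    (1 - a * z) * qQuot a q z = (1 - q * z) * qQuot a q (q * z) := by
  have h1 : qPochInf (a * z) q ≠ 0 := qPochInf_ne_zero hq h
  have h2 := qPochInf_eq hq (a * z)
  have h3 := qPochInf_eq hq (q * z)
  have h4 : qPochInf (a * (q * z)) q ≠ 0 := by
    intro h0
    rw [show q * (a * z) = a * (q * z) by ring, h0, mul_zero] at h2
    exact h1 h2
  have h5 : 1 - a * z ≠ 0 := by
    intro h0
    rw [h0, zero_mul] at h2
    exact h1 h2
  rw [qQuot, qQuot, h3, h2, show q * (a * z) = a * (q * z) by ring]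
  field_simp

lemma differentiableAt_qQuot {q : ℂ} (hq : ‖q‖ < 1) {a z : ℂ} (h : ‖a * z‖ < 1) :
    DifferentiableAt ℂ (qQuot a q) z := by
  unfold qQuot
  have hd := differentiable_qPochInf hq
  refine DifferentiableAt.fun_div ?_ ?_ (qPochInf_ne_zero hq h)
  · exact (hd (q * z)).comp z (by fun_prop)
  · exact (hd (a * z)).comp z (by fun_prop)

lemma conj_qQuot {q : ℝ} (hq0 : 0 < q) (hq1 : q < 1) (a z : ℂ) :
    conj (qQuot a q z) = qQuot (conj a) q (conj z) := by
  simp [qQuot, conj_qPochInf hq0 hq1]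

/-! ### Means over the unit circle -/

/-- The mean value of a function over the unit circle. -/
def circMean (f : ℂ → ℂ) : ℂ :=
  (2 * Real.pi : ℂ)⁻¹ * ∫ θ in (0 : ℝ)..2 * Real.pi, f (circleMap 0 1 θ)

/-- Cauchy's theorem on an annulus for f(z)/z: the integrals over the two boundary circles agree. -/
lemma circMean_eq_of_annulus {f : ℂ → ℂ} {r : ℝ} (hr0 : 0 < r) (hr1 : r ≤ 1)
    (hf : ∀ z : ℂ, r ≤ ‖z‖ → ‖z‖ ≤ 1 → DifferentiableAt ℂ f z) :
    circMean f = circMean fun z => f (r * z) := by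
  have key := Complex.circleIntegral_sub_center_inv_smul_eq_of_differentiable_on_annulus_off_countable
    (c := 0) hr0 hr1 (f := f) (s := ∅) Set.countable_empty
    (fun z hz => (hf z (by simpa using hz.2) (by simpa using hz.1)).continuousAt.continuousWithinAt)
    (fun z hz => hf z (by simpa using le_of_lt (not_le.mp (fun h => hz.1.2 (by simpa using h))))
      (by simpa using le_of_lt (mem_ball_zero_iff.mp hz.1.1)))
  have h : ∀ R : ℝ, 0 < R → (∮ z in C(0, R), (z - 0)⁻¹ • f z) =
      Complex.I * ∫ θ in (0 : ℝ)..2 * Real.pi, f (circleMap 0 R θ) := by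
    intro R hR
    rw [circleIntegral, ← intervalIntegral.integral_const_mul]
    congr 1
    ext θ
    have : circleMap 0 R θ ≠ 0 := circleMap_ne_center hR.ne'
    simp only [deriv_circleMap, sub_zero, smul_eq_mul]
    field_simp
  rw [h 1 one_pos, h r hr0] at key
  have key' := mul_left_cancel₀ Complex.I_ne_zero key
  rw [circMean, circMean, key']
  simp [circleMap]

lemma circMean_congr {f g : ℂ → ℂ} (h : ∀ z : ℂ, ‖z‖ = 1 → f z = g z) :
    circMean f = circMean g := by
  unfold circMean
  congr 2
  ext θ
  exact h _ (by simp)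

lemma continuous_comp_circleMap {f : ℂ → ℂ} (hf : ∀ z : ℂ, ‖z‖ = 1 → ContinuousAt f z) :
    Continuous fun θ : ℝ => f (circleMap 0 1 θ) :=
  continuous_iff_continuousAt.mpr fun θ =>
    ContinuousAt.comp (f := circleMap 0 1) (hf _ (by simp)) (continuous_circleMap 0 1).continuousAt

lemma circMean_sub {f g : ℂ → ℂ} (hf : ∀ z : ℂ, ‖z‖ = 1 → ContinuousAt f z)
    (hg : ∀ z : ℂ, ‖z‖ = 1 → ContinuousAt g z) :
    circMean (fun z => f z - g z) = circMean f - circMean g := by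
  rw [circMean, intervalIntegral.integral_sub, mul_sub, circMean, circMean]
  · exact (continuous_comp_circleMap hf).intervalIntegrable _ _
  · exact (continuous_comp_circleMap hg).intervalIntegrable _ _

lemma circMean_const_mul (c : ℂ) (f : ℂ → ℂ) :
    circMean (fun z => c * f z) = c * circMean f := by
  rw [circMean, intervalIntegral.integral_const_mul, circMean]
  ring

/-- The Fourier coefficients of a function on the unit circle. -/
def circCoeff (f : ℂ → ℂ) (n : ℤ) : ℂ := circMean fun z => z ^ (-n) * f z

lemma circCoeff_congr {f g : ℂ → ℂ} (h : ∀ z : ℂ, ‖z‖ = 1 → f z = g z) (n : ℤ) :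
    circCoeff f n = circCoeff g n :=
  circMean_congr fun z hz => by rw [h z hz]

lemma ne_zero_of_norm_eq_one {z : ℂ} (hz : ‖z‖ = 1) : z ≠ 0 := by
  rintro rfl
  simp at hz

lemma circCoeff_sub_mul {f : ℂ → ℂ} (hf : ∀ z : ℂ, ‖z‖ = 1 → ContinuousAt f z) (c : ℂ)
    (s n : ℤ) : circCoeff (fun z => (1 - c * z ^ s) * f z) n =
      circCoeff f n - c * circCoeff f (n - s) := by
  have hc : ∀ m : ℤ, ∀ z : ℂ, ‖z‖ = 1 → ContinuousAt (fun z => z ^ m * f z) z := fun m z hz =>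
    (continuousAt_zpow₀ z m (Or.inl (ne_zero_of_norm_eq_one hz))).mul (hf z hz)
  unfold circCoeff
  rw [← circMean_const_mul, ← circMean_sub (g := fun z => c * (z ^ (-(n - s)) * f z)) (hc _)
    fun z hz => continuousAt_const.mul (hc _ z hz)]
  refine circMean_congr fun z hz => ?_
  rw [show -(n - s) = -n + s by ring, zpow_add₀ (ne_zero_of_norm_eq_one hz)]
  ring

/-- The Fourier coefficients of `(qz; q)_∞ (q/z; q)_∞ / ((az; q)_∞ (a'/z; q)_∞)` satisfy a
`q`-hypergeometric recurrence, as in Ramanujan's `₁ψ₁` summation. -/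
lemma circCoeff_qQuot_recurrence {q : ℝ} (hq0 : 0 < q) (hq1 : q < 1) {a a' : ℂ} (ha : ‖a‖ < 1)
    (ha' : ‖a'‖ < 1) (n : ℤ) :
    (1 - a' * (q : ℂ) ^ n) *
        (circCoeff (fun z => qQuot a q z * qQuot a' q z⁻¹) (n + 1) -
          circCoeff (fun z => qQuot a q z * qQuot a' q z⁻¹) n) =
      (a - (q : ℂ) ^ n) *
        (circCoeff (fun z => qQuot a q z * qQuot a' q z⁻¹) n -
          circCoeff (fun z => qQuot a q z * qQuot a' q z⁻¹) (n - 1)) := by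
  have hqC : (q : ℂ) ≠ 0 := by exact_mod_cast hq0.ne'
  have hq : ‖(q : ℂ)‖ < 1 := by simpa [abs_of_pos hq0] using hq1
  have hqn : ‖(q : ℂ)‖ = q := by simp [abs_of_pos hq0]
  have hlt : ∀ {a z : ℂ}, ‖a‖ < 1 → ‖z‖ ≤ 1 → ‖a * z‖ < 1 := by
    intro a z h1 h2
    rw [norm_mul]
    nlinarith [norm_nonneg a, norm_nonneg z]
  have hD : ∀ {a z : ℂ}, ‖a‖ < 1 → ‖z‖ ≤ 1 → DifferentiableAt ℂ (qQuot a q) z :=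
    fun h1 h2 => differentiableAt_qQuot hq (hlt h1 h2)
  have hqz : ∀ {z : ℂ}, ‖z‖ ≤ 1 → ‖(q : ℂ) * z‖ ≤ 1 := fun h => (hlt hq h).le
  have hinv : ∀ {z : ℂ}, ‖z‖ = 1 → ‖z⁻¹‖ ≤ 1 := fun h => by simp [h]
  -- continuity of the factors on the unit circle
  have c1 : ∀ z : ℂ, ‖z‖ = 1 → ContinuousAt (qQuot a q) z := fun z hz => (hD ha hz.le).continuousAt
  have c2 : ∀ z : ℂ, ‖z‖ = 1 → ContinuousAt (fun z => qQuot a q (q * z)) z := fun z hz =>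
    ContinuousAt.comp (f := fun z => (q : ℂ) * z) (hD ha (hqz hz.le)).continuousAt (by fun_prop)
  have ci : ∀ z : ℂ, ‖z‖ = 1 → ContinuousAt (fun z : ℂ => z⁻¹) z := fun z hz =>
    continuousAt_inv₀ (ne_zero_of_norm_eq_one hz)
  have c3 : ∀ z : ℂ, ‖z‖ = 1 → ContinuousAt (fun z => qQuot a' q z⁻¹) z := fun z hz =>
    ContinuousAt.comp (f := fun z : ℂ => z⁻¹) (hD ha' (hinv hz)).continuousAt (ci z hz)
  have c4 : ∀ z : ℂ, ‖z‖ = 1 → ContinuousAt (fun z => qQuot a' q (q * z⁻¹)) z := fun z hz =>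
    ContinuousAt.comp (f := fun z : ℂ => (q : ℂ) * z⁻¹) (hD ha' (hqz (hinv hz))).continuousAt
      (continuousAt_const.mul (ci z hz))
  set w : ℂ → ℂ := fun z => qQuot a q z * qQuot a' q z⁻¹ with hw
  -- In `e` and `g` one of the two factors of `w` has its argument multiplied by q; the substitution
  -- z ↦ qz turns `e` into `g`.
  set e : ℂ → ℂ := fun z => qQuot a q z * qQuot a' q (q * z⁻¹) with he
  set g : ℂ → ℂ := fun z => qQuot a q (q * z) * qQuot a' q z⁻¹ with hg
  have cw : ∀ z : ℂ, ‖z‖ = 1 → ContinuousAt w z := fun z hz => (c1 z hz).mul (c3 z hz)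
  have ce : ∀ z : ℂ, ‖z‖ = 1 → ContinuousAt e z := fun z hz => (c1 z hz).mul (c4 z hz)
  have cg : ∀ z : ℂ, ‖z‖ = 1 → ContinuousAt g z := fun z hz => (c2 z hz).mul (c3 z hz)
  have E1 : ∀ n : ℤ, circCoeff w n - a' * circCoeff w (n + 1) =
      circCoeff e n - q * circCoeff e (n + 1) := by
    intro n
    have h1 := circCoeff_sub_mul cw a' (-1) n
    have h2 := circCoeff_sub_mul ce q (-1) n
    rw [sub_neg_eq_add] at h1 h2
    rw [← h1, ← h2]
    refine circCoeff_congr (fun z hz => ?_) n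
    have h := qQuot_eq hq (hlt ha' (hinv hz))
    simp only [hw, he, zpow_neg_one]
    linear_combination qQuot a q z * h
  have E2 : ∀ n : ℤ, circCoeff w n - a * circCoeff w (n - 1) =
      circCoeff g n - q * circCoeff g (n - 1) := by
    intro n
    rw [← circCoeff_sub_mul cw a 1 n, ← circCoeff_sub_mul cg q 1 n]
    refine circCoeff_congr (fun z hz => ?_) n
    have h := qQuot_eq hq (hlt ha hz.le)
    simp only [hw, hg, zpow_one]
    linear_combination qQuot a' q z⁻¹ * h
  -- moving the contour from the circle of radius `1` to the circle of radius `q`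
  have E3 : ∀ n : ℤ, circCoeff g n = (q : ℂ) ^ n * circCoeff e n := by
    intro n
    -- The contour can be moved for `e` because |z| ≤ 1 and |q/z| ≤ 1 both hold on q ≤ |z| ≤ 1, so
    -- neither factor meets a pole.
    have h := circMean_eq_of_annulus (f := fun z => z ^ (-n) * e z) hq0 hq1.le ?_
    · rw [circCoeff, circCoeff, h, ← circMean_const_mul]
      refine circMean_congr fun z hz => ?_
      have hz0 := ne_zero_of_norm_eq_one hz
      simp only [he, hg]
      rw [show (q : ℂ) * ((q : ℂ) * z)⁻¹ = z⁻¹ by field_simp, mul_zpow, ← mul_assoc, ← mul_assoc,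
        ← mul_assoc, ← mul_assoc, zpow_neg (q : ℂ), mul_inv_cancel₀ (zpow_ne_zero _ hqC), one_mul]
    · intro z h1 h2
      have hz0 : z ≠ 0 := by
        rintro rfl
        simp at h1
        linarith
      have h3 : ‖(q : ℂ) * z⁻¹‖ ≤ 1 := by
        rw [norm_mul, norm_inv, hqn]
        exact mul_inv_le_one_of_le₀ h1 (norm_nonneg z)
      refine ((differentiableAt_zpow (m := -n)).mpr (Or.inl hz0)).mul ((hD ha h2).mul ?_)
      exact DifferentiableAt.comp z (hD ha' h3)
        ((differentiableAt_const _).mul (differentiableAt_inv hz0))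
  have p1 : (q : ℂ) ^ (n + 1) = (q : ℂ) ^ n * q := zpow_add_one₀ hqC n
  have p2 : (q : ℂ) ^ n = (q : ℂ) ^ (n - 1) * q := by
    rw [← zpow_add_one₀ hqC]; simp
  have h1 := E1 n
  have h2 := E1 (n - 1)
  have h3 := E2 n
  have h4 := E2 (n + 1)
  rw [E3, E3] at h3 h4
  rw [add_sub_cancel_right, p1] at h4
  rw [sub_add_cancel] at h2
  rw [p2] at *
  -- Once `g` is expressed through `e`, the coefficients of `e` cancel between consecutive instances
  -- of `E1` and `E2`.
  linear_combination h4 - h3 + (q : ℂ) ^ (n - 1) * q * h1 - (q : ℂ) ^ (n - 1) * q * h2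

/-! ### The inner product of a finite measure on the unit circle -/

lemma integrable_of_continuous {μ : Measure Circle} [IsFiniteMeasure μ] {E : Type*}
    [NormedAddCommGroup E] {f : Circle → E} (hf : Continuous f) : Integrable f μ :=
  hf.integrable_of_hasCompactSupport (HasCompactSupport.of_compactSpace f)

lemma continuous_eval_circle (f : ℂ[X]) : Continuous fun ζ : Circle => f.eval (ζ : ℂ) :=
  f.continuous.comp continuous_subtype_val

lemma continuous_conj_eval_mul_eval (f g : ℂ[X]) :
    Continuous fun ζ : Circle => conj (f.eval (ζ : ℂ)) * g.eval (ζ : ℂ) :=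
  (Complex.continuous_conj.comp (continuous_eval_circle f)).mul (continuous_eval_circle g)

lemma ip_add_right (μ : Measure Circle) [IsFiniteMeasure μ] (f g h : ℂ[X]) :
    ip μ f (g + h) = ip μ f g + ip μ f h := by
  rw [ip, ip, ip, ← integral_add (integrable_of_continuous (continuous_conj_eval_mul_eval f g))
    (integrable_of_continuous (continuous_conj_eval_mul_eval f h))]
  congr 1
  ext ζ
  rw [Polynomial.eval_add]
  ring

lemma ip_C_mul_right (μ : Measure Circle) (c : ℂ) (f g : ℂ[X]) :
    ip μ f (Polynomial.C c * g) = c * ip μ f g := by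
  rw [ip, ip, ← integral_const_mul]
  congr 1
  ext ζ
  rw [Polynomial.eval_mul, Polynomial.eval_C]
  ring

lemma ip_zero_right (μ : Measure Circle) (f : ℂ[X]) : ip μ f 0 = 0 := by simp [ip]

lemma ip_sub_right (μ : Measure Circle) [IsFiniteMeasure μ] (f g h : ℂ[X]) :
    ip μ f (g - h) = ip μ f g - ip μ f h := by
  rw [show g - h = g + Polynomial.C (-1) * h by simp [sub_eq_add_neg], ip_add_right,
    ip_C_mul_right]
  ring

lemma ip_sum_right (μ : Measure Circle) [IsFiniteMeasure μ] {ι : Type*} (s : Finset ι) (f : ℂ[X])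
    (g : ι → ℂ[X]) : ip μ f (∑ i ∈ s, g i) = ∑ i ∈ s, ip μ f (g i) := by
  classical
  induction s using Finset.induction_on with
  | empty => simp [ip_zero_right]
  | insert i s hi ih => rw [Finset.sum_insert hi, Finset.sum_insert hi, ip_add_right, ih]

lemma conj_ip (μ : Measure Circle) (f g : ℂ[X]) : conj (ip μ f g) = ip μ g f := by
  rw [ip, ip, ← integral_conj]
  congr 1
  ext ζ
  simp [mul_comm]

lemma ip_C_mul_left (μ : Measure Circle) (c : ℂ) (f g : ℂ[X]) :
    ip μ (Polynomial.C c * f) g = conj c * ip μ f g := by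
  rw [← conj_ip, ip_C_mul_right, map_mul, conj_ip]

lemma ip_sub_left (μ : Measure Circle) [IsFiniteMeasure μ] (f g h : ℂ[X]) :
    ip μ (f - g) h = ip μ f h - ip μ g h := by
  rw [← conj_ip, ip_sub_right, map_sub, conj_ip, conj_ip]

lemma ip_sum_left (μ : Measure Circle) [IsFiniteMeasure μ] {ι : Type*} (s : Finset ι)
    (f : ι → ℂ[X]) (g : ℂ[X]) : ip μ (∑ i ∈ s, f i) g = ∑ i ∈ s, ip μ (f i) g := by
  rw [← conj_ip, ip_sum_right, map_sum]
  simp_rw [conj_ip]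

lemma ip_self (μ : Measure Circle) (f : ℂ[X]) :
    ip μ f f = ((∫ ζ : Circle, ‖f.eval (ζ : ℂ)‖ ^ 2 ∂μ : ℝ) : ℂ) := by
  refine Eq.trans ?_ (integral_ofReal (𝕜 := ℂ))
  rw [ip]
  congr 1
  ext ζ
  rw [Complex.conj_mul']
  exact (Complex.ofReal_pow _ _).symm

/-- The moments `∫ ζ^{-n} dμ(ζ)`. -/
def circMoment (μ : Measure Circle) (n : ℤ) : ℂ := ∫ ζ : Circle, (ζ : ℂ) ^ (-n) ∂μ

lemma conj_coe_circle (ζ : Circle) : conj (ζ : ℂ) = (ζ : ℂ)⁻¹ :=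
  (Circle.coe_inv_eq_conj ζ).symm.trans (Circle.coe_inv ζ)

lemma conj_circMoment (μ : Measure Circle) (n : ℤ) :
    conj (circMoment μ n) = circMoment μ (-n) := by
  rw [circMoment, circMoment, ← integral_conj]
  congr 1
  ext ζ
  rw [map_zpow₀, conj_coe_circle, inv_zpow, ← zpow_neg]

lemma ip_X_pow_X_pow (μ : Measure Circle) (i j : ℕ) :
    ip μ (Polynomial.X ^ j) (Polynomial.X ^ i) = circMoment μ (j - i) := by
  rw [ip, circMoment]
  congr 1
  ext ζ
  rw [Polynomial.eval_X_pow, Polynomial.eval_X_pow, map_pow, conj_coe_circle, neg_sub,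
    sub_eq_add_neg, zpow_add₀ (Circle.coe_ne_zero ζ), zpow_neg, zpow_natCast, zpow_natCast,
    inv_pow, mul_comm]

/-- Multiplication by ζ is an isometry, because |ζ| = 1. -/
lemma ip_X_pow_succ_X_mul (μ : Measure Circle) (j : ℕ) (f : ℂ[X]) :
    ip μ (Polynomial.X ^ (j + 1)) (Polynomial.X * f) = ip μ (Polynomial.X ^ j) f := by
  rw [ip, ip]
  congr 1
  ext ζ
  have := Circle.coe_ne_zero ζ
  rw [Polynomial.eval_X_pow, Polynomial.eval_X_pow, Polynomial.eval_mul, Polynomial.eval_X,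
    map_pow, map_pow, conj_coe_circle, pow_succ, mul_assoc, inv_mul_cancel_left₀ this]

/-- The factor 1 - X turns moments into their first differences, the sequence to which the
telescoping recurrence applies. -/
lemma ip_X_pow_one_sub_X_mul_qUltraPoly (μ : Measure Circle) [IsFiniteMeasure μ] (a a' q : ℂ)
    (k j : ℕ) :
    ip μ (Polynomial.X ^ j) ((1 - Polynomial.X) * qUltraPoly a a' q k) =
      qUltraConv a a' q (fun n => circMoment μ n - circMoment μ (n - 1)) k j := by
  rw [qUltraPoly, Finset.mul_sum, ip_sum_right, qUltraConv]
  refine Finset.sum_congr rfl fun i _ => ?_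
  rw [mul_left_comm, ip_C_mul_right, sub_mul, one_mul, ip_sub_right, ← pow_succ',
    ip_X_pow_X_pow, ip_X_pow_X_pow]
  push_cast
  rw [sub_add_eq_sub_sub]

/-- If `g` has the same inner product `s` with `1, X, …, X^k`, then `g` reproduces, up to the
factor `s`, the value at `1` of the polynomials of degree at most `k`. -/
lemma ip_eq_conj_eval_one_mul {μ : Measure Circle} [IsFiniteMeasure μ] {k : ℕ} {g : ℂ[X]} {s : ℂ}
    (h : ∀ i ≤ k, ip μ (Polynomial.X ^ i) g = s) {f : ℂ[X]} (hf : f.natDegree ≤ k) :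
    ip μ f g = conj (f.eval 1) * s := by
  have hs := f.as_sum_range' (k + 1) (Nat.lt_succ_of_le hf)
  rw [hs, ip_sum_left, Polynomial.eval_finsetSum, map_sum, Finset.sum_mul]
  refine Finset.sum_congr rfl fun i hi => ?_
  rw [← Polynomial.C_mul_X_pow_eq_monomial, ip_C_mul_left,
    h i (Nat.lt_succ_iff.mp (Finset.mem_range.mp hi))]
  simp

/-- Monic polynomials of all degrees span: a polynomial of degree less than `k` is orthogonal to
the `k`-th monic orthogonal polynomial. -/
lemma IsMonicOPUC.ip_eq_zero {μ : Measure Circle} [IsFiniteMeasure μ] {Φ : ℕ → ℂ[X]}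
    (h : IsMonicOPUC μ Φ) {k : ℕ} {f : ℂ[X]} (hf : f.degree < k) : ip μ f (Φ k) = 0 := by
  induction hn : f.natDegree using Nat.strong_induction_on generalizing f with
  | _ n ih =>
    subst hn
    by_cases hf0 : f = 0
    · rw [hf0, ← conj_ip, ip_zero_right, map_zero]
    have hd := (h.1 f.natDegree).2
    have hm := (h.1 f.natDegree).1
    -- Removing the leading term with a multiple of the monic polynomial of the same degree lowers
    -- the degree and feeds the induction.
    set p := Polynomial.C f.leadingCoeff * Φ f.natDegree with hp
    have hlc : f.leadingCoeff ≠ 0 := Polynomial.leadingCoeff_ne_zero.mpr hf0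
    have hpd : f.degree = p.degree := by
      rw [hp, Polynomial.degree_C_mul hlc, Polynomial.degree_eq_natDegree hm.ne_zero, hd,
        Polynomial.degree_eq_natDegree hf0]
    have hlt : (f - p).degree < f.degree :=
      Polynomial.degree_sub_lt_left hpd hf0 (by rw [hp, Polynomial.leadingCoeff_mul, hm.leadingCoeff]; simp)
    have hk : f.natDegree < k := (Polynomial.natDegree_lt_iff_degree_lt hf0).mpr hf
    have h1 : ip μ p (Φ k) = 0 := by
      rw [hp, ip_C_mul_left, h.2 _ _ hk.ne, mul_zero]
    have h2 : ip μ (f - p) (Φ k) = 0 := by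
      by_cases h0 : f - p = 0
      · rw [h0, ← conj_ip, ip_zero_right, map_zero]
      · exact ih _ (Polynomial.natDegree_lt_natDegree h0 hlt) (hlt.trans hf) rfl
    rw [ip_sub_left, h1, sub_zero] at h2
    exact h2

/-- Uniqueness of the monic orthogonal polynomials of a positive definite inner product. -/
lemma IsMonicOPUC.unique {μ : Measure Circle} [IsFiniteMeasure μ]
    (hpos : ∀ f : ℂ[X], f ≠ 0 → 0 < (ip μ f f).re) {Φ Ψ : ℕ → ℂ[X]} (hΦ : IsMonicOPUC μ Φ)
    (hΨ : IsMonicOPUC μ Ψ) : Ψ = Φ := by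
  ext1 k
  by_contra hne
  have hdeg : ∀ {X : ℕ → ℂ[X]}, IsMonicOPUC μ X → (X k).degree = k := fun h => by
    rw [Polynomial.degree_eq_natDegree (h.1 k).1.ne_zero, (h.1 k).2]
  have hlt : (Ψ k - Φ k).degree < k := by
    rw [← hdeg hΨ]
    refine Polynomial.degree_sub_lt_left (by rw [hdeg hΨ, hdeg hΦ]) (hΨ.1 k).1.ne_zero ?_
    rw [(hΨ.1 k).1.leadingCoeff, (hΦ.1 k).1.leadingCoeff]
  have h := hpos _ (sub_ne_zero.mpr hne)
  -- The difference has degree below k, so it is orthogonal to both polynomials and hence to itself.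
  rw [ip_sub_right, hΨ.ip_eq_zero hlt, hΦ.ip_eq_zero hlt] at h
  simp at h

/-! ### The measure -/

lemma norm_cpow_bParam {q : ℝ} (hq0 : 0 < q) (lam eta : ℝ) :
    ‖(q : ℂ) ^ bParam lam eta‖ = q ^ lam := by
  rw [Complex.norm_cpow_eq_rpow_re_of_pos hq0]
  simp [bParam]

lemma norm_cpow_bParam_lt_one {q lam : ℝ} (hq0 : 0 < q) (hq1 : q < 1) (hlam : 0 < lam) (eta : ℝ) :
    ‖(q : ℂ) ^ bParam lam eta‖ < 1 := by
  rw [norm_cpow_bParam hq0]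
  exact Real.rpow_lt_one hq0.le hq1 hlam

lemma measurable_circle_exp : Measurable Circle.exp :=
  Circle.exp.continuous.measurable

instance isFiniteMeasure_arcLength : IsFiniteMeasure arcLength := by
  unfold arcLength
  have : IsFiniteMeasure (Measure.map Circle.exp
      ((volume : Measure ℝ).restrict (Set.Ioc 0 (2 * Real.pi)))) := by
    refine Measure.isFiniteMeasure_map _ _
  exact Measure.smul_finite _ ENNReal.ofReal_ne_top

lemma coe_circle_exp (θ : ℝ) : (Circle.exp θ : ℂ) = circleMap 0 1 θ := by
  simp [circleMap, Circle.coe_exp]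

lemma integral_arcLength {E : Type*} [NormedAddCommGroup E] [NormedSpace ℝ E]
    [SecondCountableTopology E] {f : Circle → E}
    (hf : Continuous f) : ∫ ζ, f ζ ∂arcLength =
      (2 * Real.pi)⁻¹ • ∫ θ in (0 : ℝ)..2 * Real.pi, f (Circle.exp θ) := by
  borelize E
  rw [arcLength, integral_smul_measure, integral_map measurable_circle_exp.aemeasurable
    hf.aestronglyMeasurable,
    ← intervalIntegral.integral_of_le (by positivity), ENNReal.toReal_ofReal (by positivity)]
  simp

/-- The weight as an analytic function, away from the poles. -/
def weightFun (q lam eta : ℝ) (z : ℂ) : ℂ :=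
  qQuot ((q : ℂ) ^ bParam lam eta) q z * qQuot (conj ((q : ℂ) ^ bParam lam eta)) q z⁻¹

section

variable {q lam eta : ℝ}

/-- On the circle 1/ζ is the conjugate of ζ, so the second factor is the conjugate of the first. -/
lemma weightFun_coe (hq0 : 0 < q) (hq1 : q < 1) (ζ : Circle) :
    weightFun q lam eta ζ = (weight q lam eta ζ : ℂ) := by
  rw [weightFun, ← conj_coe_circle, ← conj_qQuot hq0 hq1, Complex.mul_conj', weight, qQuot,
    norm_div]
  push_cast
  rw [div_pow]

lemma continuousAt_weightFun (hq0 : 0 < q) (hq1 : q < 1) (hlam : 0 < lam) {z : ℂ}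
    (hz : ‖z‖ = 1) : ContinuousAt (weightFun q lam eta) z := by
  have hq : ‖(q : ℂ)‖ < 1 := by simpa [abs_of_pos hq0] using hq1
  have ha := norm_cpow_bParam_lt_one hq0 hq1 hlam eta
  refine ContinuousAt.mul (differentiableAt_qQuot hq ?_).continuousAt
    (ContinuousAt.comp (f := fun z : ℂ => z⁻¹)
    (differentiableAt_qQuot hq ?_).continuousAt (continuousAt_inv₀ (ne_zero_of_norm_eq_one hz)))
  · rwa [norm_mul, hz, mul_one]
  · rwa [norm_mul, norm_inv, hz, inv_one, mul_one, Complex.norm_conj]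

lemma continuous_weight (hq0 : 0 < q) (hq1 : q < 1) (hlam : 0 < lam) :
    Continuous (weight q lam eta) := by
  have h : weight q lam eta = fun ζ : Circle => (weightFun q lam eta ζ).re := by
    ext ζ
    rw [weightFun_coe hq0 hq1, Complex.ofReal_re]
  rw [h]
  refine Complex.continuous_re.comp (continuous_iff_continuousAt.mpr fun ζ => ?_)
  exact ContinuousAt.comp (f := fun ζ : Circle => (ζ : ℂ))
    (continuousAt_weightFun hq0 hq1 hlam (Circle.norm_coe ζ)) continuous_subtype_val.continuousAt

lemma weight_nonneg (ζ : Circle) : 0 ≤ weight q lam eta ζ := by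
  unfold weight
  positivity

lemma qPochInf_q_mul_ne_zero (hq0 : 0 < q) (hq1 : q < 1) (ζ : Circle) :
    qPochInf ((q : ℂ) * ζ) q ≠ 0 := by
  have hq : ‖(q : ℂ)‖ < 1 := by simpa [abs_of_pos hq0] using hq1
  exact qPochInf_ne_zero hq (by rwa [norm_mul, Circle.norm_coe, mul_one])

lemma weight_pos (hq0 : 0 < q) (hq1 : q < 1) (hlam : 0 < lam) (ζ : Circle) :
    0 < weight q lam eta ζ := by
  have hq : ‖(q : ℂ)‖ < 1 := by simpa [abs_of_pos hq0] using hq1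
  have h1 := norm_pos_iff.mpr (qPochInf_q_mul_ne_zero hq0 hq1 ζ)
  have h2 : 0 < ‖qPochInf ((q : ℂ) ^ bParam lam eta * ζ) q‖ :=
    norm_pos_iff.mpr (qPochInf_ne_zero hq (by
      rw [norm_mul, Circle.norm_coe, mul_one]; exact norm_cpow_bParam_lt_one hq0 hq1 hlam eta))
  unfold weight
  positivity

lemma isFiniteMeasure_muCheck (hq0 : 0 < q) (hq1 : q < 1) (hlam : 0 < lam) (ρ : ℝ) :
    IsFiniteMeasure (muCheck q lam eta ρ) :=
  isFiniteMeasure_withDensity_ofReal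
    (integrable_of_continuous ((continuous_weight hq0 hq1 hlam).const_mul ρ)).2

lemma integral_muCheck (hq0 : 0 < q) (hq1 : q < 1) (hlam : 0 < lam) {ρ : ℝ} (hρ : 0 < ρ)
    {E : Type*} [NormedAddCommGroup E] [NormedSpace ℝ E] (f : Circle → E) :
    ∫ ζ, f ζ ∂muCheck q lam eta ρ = ∫ ζ, (ρ * weight q lam eta ζ) • f ζ ∂arcLength := by
  rw [muCheck, integral_withDensity_eq_integral_toReal_smul]
  · congr 1
    ext ζ
    rw [ENNReal.toReal_ofReal (mul_nonneg hρ.le (weight_nonneg ζ))]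
  · exact ((continuous_weight hq0 hq1 hlam).const_mul ρ).measurable.ennreal_ofReal
  · simp

lemma circMoment_muCheck (hq0 : 0 < q) (hq1 : q < 1) (hlam : 0 < lam) {ρ : ℝ} (hρ : 0 < ρ)
    (n : ℤ) : circMoment (muCheck q lam eta ρ) n = ρ * circCoeff (weightFun q lam eta) n := by
  have hc : Continuous fun ζ : Circle => (ζ : ℂ) ^ (-n) :=
    continuous_iff_continuousAt.mpr fun ζ =>
      ContinuousAt.comp (f := fun ζ : Circle => (ζ : ℂ))
        (continuousAt_zpow₀ _ _ (Or.inl (Circle.coe_ne_zero ζ)))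
        continuous_subtype_val.continuousAt
  rw [circMoment, integral_muCheck hq0 hq1 hlam hρ, integral_arcLength, circCoeff, circMean]
  · rw [mul_left_comm, ← intervalIntegral.integral_const_mul, Complex.real_smul]
    push_cast
    congr 2
    ext θ
    rw [Complex.real_smul, ← coe_circle_exp, weightFun_coe hq0 hq1]
    push_cast
    ring
  · exact ((continuous_weight hq0 hq1 hlam).const_mul ρ).smul hc

lemma circMoment_muCheck_recurrence (hq0 : 0 < q) (hq1 : q < 1) (hlam : 0 < lam) {ρ : ℝ}
    (hρ : 0 < ρ) (n : ℤ) :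
    (1 - conj ((q : ℂ) ^ bParam lam eta) * (q : ℂ) ^ n) *
        (circMoment (muCheck q lam eta ρ) (n + 1) - circMoment (muCheck q lam eta ρ) n) =
      ((q : ℂ) ^ bParam lam eta - (q : ℂ) ^ n) *
        (circMoment (muCheck q lam eta ρ) n - circMoment (muCheck q lam eta ρ) (n - 1)) := by
  have ha := norm_cpow_bParam_lt_one hq0 hq1 hlam eta
  simp only [circMoment_muCheck hq0 hq1 hlam hρ]
  have h := circCoeff_qQuot_recurrence hq0 hq1 ha
    (a' := conj ((q : ℂ) ^ bParam lam eta)) (by rwa [Complex.norm_conj]) n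
  change _ * (circCoeff (weightFun q lam eta) _ - circCoeff (weightFun q lam eta) _) =
    _ * (circCoeff (weightFun q lam eta) _ - circCoeff (weightFun q lam eta) _) at h
  linear_combination (ρ : ℂ) * h

/-- The density is continuous and strictly positive, and a nonzero polynomial has only finitely many
zeros; some θ in the open period avoids them. -/
lemma ip_self_muCheck_pos (hq0 : 0 < q) (hq1 : q < 1) (hlam : 0 < lam) {ρ : ℝ} (hρ : 0 < ρ)
    {f : ℂ[X]} (hf : f ≠ 0) : 0 < (ip (muCheck q lam eta ρ) f f).re := by
  have hc : Continuous fun ζ : Circle => (ρ * weight q lam eta ζ) • ‖f.eval (ζ : ℂ)‖ ^ 2 :=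
    ((continuous_weight hq0 hq1 hlam).const_mul ρ).smul ((continuous_eval_circle f).norm.pow 2)
  rw [ip_self, Complex.ofReal_re, integral_muCheck hq0 hq1 hlam hρ, integral_arcLength hc,
    smul_eq_mul]
  refine mul_pos (by positivity) (intervalIntegral.integral_pos (by positivity)
    (hc.comp Circle.exp.continuous).continuousOn (fun θ _ => ?_) ?_)
  · have := weight_nonneg (q := q) (lam := lam) (eta := eta) (Circle.exp θ)
    rw [smul_eq_mul]
    positivity
  · have hcount : (circleMap 0 1 ⁻¹' (f.roots.toFinset : Set ℂ)).Countable :=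
      f.roots.toFinset.countable_toSet.preimage_circleMap 0 one_ne_zero
    obtain ⟨θ, hθ, hθ'⟩ := (hcount.dense_compl ℝ).exists_mem_open isOpen_Ioo
      (Set.nonempty_Ioo.mpr (show (0 : ℝ) < 2 * Real.pi by positivity))
    refine ⟨θ, Set.Ioo_subset_Icc_self hθ', ?_⟩
    have hne : f.eval (Circle.exp θ : ℂ) ≠ 0 := by
      rw [coe_circle_exp]
      intro h0
      exact hθ (by simpa [hf] using h0)
    have h1 := weight_pos (eta := eta) hq0 hq1 hlam (Circle.exp θ)
    have h2 := norm_pos_iff.mpr hne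
    rw [smul_eq_mul]
    positivity

lemma circMoment_arcLength (n : ℤ) : circMoment arcLength n = if n = 0 then 1 else 0 := by
  have hc : Continuous fun ζ : Circle => (ζ : ℂ) ^ (-n) :=
    continuous_iff_continuousAt.mpr fun ζ =>
      ContinuousAt.comp (f := fun ζ : Circle => (ζ : ℂ))
        (continuousAt_zpow₀ _ _ (Or.inl (Circle.coe_ne_zero ζ)))
        continuous_subtype_val.continuousAt
  rw [circMoment, integral_arcLength hc]
  split_ifs with h
  · subst h
    have : (Real.pi : ℂ) ≠ 0 := by exact_mod_cast Real.pi_ne_zero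
    simp
    field_simp
  · have hn : ((-n : ℤ) : ℂ) * Complex.I ≠ 0 := by simp [h]
    have hx : ∀ θ : ℝ, (Circle.exp θ : ℂ) ^ (-n) =
        Complex.exp ((((-n : ℤ) : ℂ) * Complex.I) * θ) := fun θ => by
      rw [Circle.coe_exp, ← Complex.exp_int_mul]
      congr 1
      ring
    simp_rw [hx]
    rw [integral_exp_mul_complex hn]
    have : (((-n : ℤ) : ℂ) * Complex.I) * ((2 * Real.pi : ℝ) : ℂ) =
        ((-n : ℤ) : ℂ) * (2 * Real.pi * Complex.I) := by push_cast; ring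
    rw [this, Complex.exp_int_mul_two_pi_mul_I]
    simp

/-- The mass of `|1 + ζ + ⋯ + ζ^n|²` grows at most linearly. -/
lemma exists_ip_geom_sum_le (hq0 : 0 < q) (hq1 : q < 1) (hlam : 0 < lam) {ρ : ℝ} (hρ : 0 < ρ) :
    ∃ B : ℝ, ∀ n : ℕ, (ip (muCheck q lam eta ρ) (∑ i ∈ Finset.range (n + 1), Polynomial.X ^ i)
      (∑ i ∈ Finset.range (n + 1), Polynomial.X ^ i)).re ≤ B * (n + 1) := by
  have hw := (continuous_weight (eta := eta) hq0 hq1 hlam).const_mul ρ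
  -- The constant is an upper bound of the density on the compact circle.
  obtain ⟨B, hB⟩ := (isCompact_univ.image hw).bddAbove
  refine ⟨B, fun n => ?_⟩
  set f : ℂ[X] := ∑ i ∈ Finset.range (n + 1), Polynomial.X ^ i with hf
  have hc : Continuous fun ζ : Circle => ‖f.eval (ζ : ℂ)‖ ^ 2 :=
    (continuous_eval_circle f).norm.pow 2
  -- For arc length the monomials are orthonormal, so `f` itself is the reproducing kernel at 1 and
  -- its squared norm is f(1).
  have harc : ip arcLength f f = n + 1 := by
    have h1 : ∀ i ≤ n, ip arcLength (Polynomial.X ^ i) f = 1 := by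
      intro i hi
      rw [hf, ip_sum_right]
      simp_rw [ip_X_pow_X_pow, circMoment_arcLength, sub_eq_zero, Nat.cast_inj]
      rw [Finset.sum_ite_eq]
      simp [Nat.lt_succ_of_le hi]
    have h2 : f.natDegree ≤ n := by
      refine Polynomial.natDegree_sum_le_of_forall_le _ _ fun i hi => ?_
      rw [Polynomial.natDegree_X_pow]
      exact Nat.lt_succ_iff.mp (Finset.mem_range.mp hi)
    rw [ip_eq_conj_eval_one_mul h1 h2, hf, Polynomial.eval_finsetSum]
    simp
  have hre : ∫ ζ : Circle, ‖f.eval (ζ : ℂ)‖ ^ 2 ∂arcLength = n + 1 := by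
    rw [ip_self] at harc
    exact_mod_cast harc
  rw [ip_self, Complex.ofReal_re, integral_muCheck hq0 hq1 hlam hρ, ← hre, ← integral_const_mul]
  refine integral_mono (integrable_of_continuous (hw.smul hc))
    (integrable_of_continuous (hc.const_mul B)) fun ζ => ?_
  exact mul_le_mul_of_nonneg_right (hB ⟨ζ, trivial, rfl⟩) (by positivity)

/-- Riemann–Lebesgue on the real line, applied to one period of the weight cut off to 0 elsewhere,
along the frequencies n/(2π). -/
lemma tendsto_circMoment_muCheck (hq0 : 0 < q) (hq1 : q < 1) (hlam : 0 < lam) {ρ : ℝ}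
    (hρ : 0 < ρ) :
    Filter.Tendsto (fun n : ℕ => circMoment (muCheck q lam eta ρ) n) Filter.atTop (nhds 0) := by
  set F : ℝ → ℂ := (Set.Ioc 0 (2 * Real.pi)).indicator
    fun θ => weightFun q lam eta (circleMap 0 1 θ) with hF
  have hRL := Real.tendsto_integral_exp_smul_cocompact F
  have hseq : Filter.Tendsto (fun n : ℕ => (n : ℝ) * (2 * Real.pi)⁻¹) Filter.atTop
      (Filter.cocompact ℝ) :=
    (tendsto_natCast_atTop_atTop.atTop_mul_const (by positivity)).mono_right
      atTop_le_cocompact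
  have hlim := (hRL.comp hseq).const_mul ((ρ : ℂ) * (2 * Real.pi : ℂ)⁻¹)
  rw [mul_zero] at hlim
  refine hlim.congr fun n => ?_
  rw [circMoment_muCheck hq0 hq1 hlam hρ, circCoeff, circMean, mul_assoc,
    intervalIntegral.integral_of_le (by positivity)]
  congr 2
  simp only [Function.comp_apply]
  rw [← integral_indicator measurableSet_Ioc]
  congr 1
  ext θ
  simp only [hF, Set.indicator]
  split_ifs with h
  · rw [Circle.smul_def, smul_eq_mul, Real.fourierChar_apply, circleMap_zero, zpow_neg,
      zpow_natCast, Complex.ofReal_one, one_mul, ← Complex.exp_nat_mul, ← Complex.exp_neg]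
    congr 2
    have : (Real.pi : ℂ) ≠ 0 := by exact_mod_cast Real.pi_ne_zero
    push_cast
    field_simp
  · simp

end

/-! ### Terminating and non-terminating `₂φ₁` series -/

lemma qPoch_inv_pow_eq_zero {q : ℂ} (hq0 : q ≠ 0) {k n : ℕ} (h : k < n) :
    qPoch (q ^ k)⁻¹ q n = 0 := by
  rw [qPoch, Finset.prod_eq_zero_iff]
  exact ⟨k, Finset.mem_range.mpr h, by rw [inv_mul_cancel₀ (pow_ne_zero _ hq0), sub_self]⟩

lemma qPoch_ne_zero {a q : ℂ} (ha : ∀ n : ℕ, 1 - a * q ^ n ≠ 0) (n : ℕ) : qPoch a q n ≠ 0 :=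
  Finset.prod_ne_zero_iff.mpr fun i _ => ha i

/-- Reverses one factor: with k = i + 1 + l, the i-th factor of (q^(1-k)/a'; q) is a nonzero
multiple of the l-th factor of (a'; q). -/
lemma one_sub_div_mul_pow {a' q : ℂ} (hq0 : q ≠ 0) (ha'0 : a' ≠ 0) (i l : ℕ) :
    1 - q / (a' * q ^ (i + 1 + l)) * q ^ i = -(1 - a' * q ^ l) / (a' * q ^ l) := by
  have h1 := pow_ne_zero i hq0
  have h2 := pow_ne_zero l hq0
  rw [pow_add, pow_succ]
  field_simp
  ring

lemma qPoch_div_ne_zero {a' q : ℂ} (hq0 : q ≠ 0) (ha'0 : a' ≠ 0)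
    (ha' : ∀ n : ℕ, 1 - a' * q ^ n ≠ 0) {k i : ℕ} (hi : i ≤ k) :
    qPoch (q / (a' * q ^ k)) q i ≠ 0 := by
  rw [qPoch, Finset.prod_ne_zero_iff]
  intro s hs
  obtain ⟨l, rfl⟩ : ∃ l, k = s + 1 + l := ⟨k - (s + 1), by
    have := Finset.mem_range.mp hs
    omega⟩
  rw [one_sub_div_mul_pow hq0 ha'0]
  exact div_ne_zero (neg_ne_zero.mpr (ha' l)) (mul_ne_zero ha'0 (pow_ne_zero _ hq0))

/-- Reversal of the order of the factors, in a form cleared of denominators; it turns the terms of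
the terminating series into the coefficients of `qUltraPoly`. -/
lemma qPoch_inv_pow_mul {a' q : ℂ} (hq0 : q ≠ 0) (ha'0 : a' ≠ 0) {k i : ℕ} (hi : i ≤ k) :
    qPoch a' q k * qPoch (q ^ k)⁻¹ q i * (q / a') ^ i * qPoch q q (k - i) =
      qPoch q q k * qPoch a' q (k - i) * qPoch (q / (a' * q ^ k)) q i := by
  induction i with
  | zero => simp [qPoch_zero, mul_comm]
  | succ i ih =>
    obtain ⟨l, rfl⟩ : ∃ l, k = i + 1 + l := ⟨k - (i + 1), by omega⟩
    have h := ih (by omega)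
    rw [show i + 1 + l - i = l + 1 by omega] at h
    rw [show i + 1 + l - (i + 1) = l by omega]
    rw [qPoch_succ q q l, qPoch_succ a' q l] at h
    rw [qPoch_succ _ q i, qPoch_succ _ q i, one_sub_div_mul_pow hq0 ha'0]
    have h1 := pow_ne_zero i hq0
    have h2 := pow_ne_zero l hq0
    have h3 : 1 - (q ^ (i + 1 + l))⁻¹ * q ^ i = -(1 - q * q ^ l) / (q * q ^ l) := by
      rw [pow_add, pow_succ]
      field_simp
      ring
    rw [h3, pow_succ (q / a')]
    have h4 : -(1 - q * q ^ l) / (q * q ^ l) * (q / a') = -(1 - q * q ^ l) / (a' * q ^ l) := by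
      field_simp
    linear_combination (-1 / (a' * q ^ l)) * h + qPoch a' q (i + 1 + l) *
      qPoch (q ^ (i + 1 + l))⁻¹ q i * (q / a') ^ i * qPoch q q l * h4

/-- The terminating `₂φ₁` series as a polynomial. -/
lemma qPoch_mul_phi21_terminating {a' q : ℂ} (hq0 : q ≠ 0) (hq : ∀ n : ℕ, 1 - q ^ (n + 1) ≠ 0)
    (ha'0 : a' ≠ 0) (ha' : ∀ n : ℕ, 1 - a' * q ^ n ≠ 0) (a z : ℂ) (k : ℕ) :
    qPoch a' q k * phi21 (q ^ k)⁻¹ a (q / (a' * q ^ k)) q (q / a' * z) =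
      qPoch q q k * (qUltraPoly a a' q k).eval z := by
  rw [phi21, tsum_eq_sum (s := Finset.range (k + 1)), eval_qUltraPoly, Finset.mul_sum,
    Finset.mul_sum]
  · refine Finset.sum_congr rfl fun i hi => ?_
    have hik : i ≤ k := Nat.lt_succ_iff.mp (Finset.mem_range.mp hi)
    have h1 := qPoch_inv_pow_mul hq0 ha'0 hik
    have h2 := qPoch_div_ne_zero hq0 ha'0 ha' hik
    have h3 := qPoch_self_ne_zero hq i
    have h4 := qPoch_self_ne_zero hq (k - i)
    rw [qBinomCoeff, qBinomCoeff, mul_pow]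
    generalize qPoch (q / (a' * q ^ k)) q i = γ at *
    generalize qPoch (q ^ k)⁻¹ q i = δ at *
    generalize (q / a') ^ i = x at *
    field_simp
    linear_combination qPoch a q i * z ^ i * h1
  · intro i hi
    rw [qPoch_inv_pow_eq_zero hq0 (by simpa using hi)]
    simp

/-- If a null sequence has `q`-hypergeometric increments, its initial value is given by a
non-terminating `₂φ₁` series. -/
lemma mul_phi21_eq_neg {q : ℝ} (hq0 : 0 < q) (hq1 : q < 1) {a a' : ℂ} (ha0 : a ≠ 0)
    (ha : ‖a‖ < 1) (ha' : ‖a'‖ < 1) {m : ℤ → ℂ}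
    (hm : ∀ n : ℤ, (1 - a' * (q : ℂ) ^ n) * (m (n + 1) - m n) =
      (a - (q : ℂ) ^ n) * (m n - m (n - 1)))
    (hlim : Filter.Tendsto (fun n : ℕ => m n) Filter.atTop (nhds 0)) :
    (m 1 - m 0) * phi21 q (q / a) (q * a') q a = -m 0 := by
  have hqn : ‖(q : ℂ)‖ = q := by simp [abs_of_pos hq0]
  have hpow : Filter.Tendsto (fun n : ℕ => (q : ℂ) ^ (n + 1)) Filter.atTop (nhds 0) :=
    (tendsto_pow_atTop_nhds_zero_of_norm_lt_one (by rwa [hqn])).comp (Filter.tendsto_add_atTop_nat 1)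
  have hne : ∀ n : ℕ, 1 - a' * (q : ℂ) ^ n ≠ 0 := by
    intro n h0
    have h1 : a' * (q : ℂ) ^ n = 1 := by linear_combination -h0
    have h2 : ‖a' * (q : ℂ) ^ n‖ < 1 := by
      rw [norm_mul, norm_pow, hqn]
      nlinarith [pow_le_one₀ hq0.le hq1.le (n := n), norm_nonneg a', pow_nonneg hq0.le n]
    simp [h1] at h2
  have hne' : ∀ n : ℕ, 1 - (q : ℂ) ^ (n + 1) ≠ 0 := by
    intro n h0
    have h1 : (q : ℂ) ^ (n + 1) = 1 := by linear_combination -h0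
    have h2 := pow_lt_one₀ hq0.le hq1 (Nat.succ_ne_zero n)
    have h3 : q ^ (n + 1) = 1 := by exact_mod_cast h1
    rw [Nat.succ_eq_add_one, h3] at h2
    exact lt_irrefl _ h2
  set t : ℕ → ℂ := fun n => qPoch q q n * qPoch (q / a) q n / (qPoch q q n * qPoch (q * a') q n) *
    a ^ n with ht
  -- The term ratio is that of the increments in `hm`, so the terms times m 1 - m 0 are the
  -- increments and the series telescopes.
  have ht_succ : ∀ n, t (n + 1) = (a - (q : ℂ) ^ (n + 1)) / (1 - a' * (q : ℂ) ^ (n + 1)) * t n := by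
    intro n
    have h1 := qPoch_self_ne_zero hne' n
    have h2 : 1 - q * (q : ℂ) ^ n ≠ 0 := by simpa [pow_succ'] using hne' n
    have h3 := hne (n + 1)
    have h4 : qPoch (q * a') q n ≠ 0 := qPoch_ne_zero (fun n => by
      have := hne (n + 1)
      rwa [show (q : ℂ) * a' * q ^ n = a' * q ^ (n + 1) by ring]) n
    have h5 : 1 - q * a' * (q : ℂ) ^ n = 1 - a' * (q : ℂ) ^ (n + 1) := by ring
    simp only [ht, qPoch_succ]
    rw [h5]
    field_simp
    ring
  have hsum : Summable t := by
    have hr : Filter.Tendsto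
        (fun n : ℕ => ‖(a - (q : ℂ) ^ (n + 1)) / (1 - a' * (q : ℂ) ^ (n + 1))‖) Filter.atTop
        (nhds ‖(a - 0) / (1 - a' * 0)‖) :=
      ((tendsto_const_nhds.sub hpow).div (tendsto_const_nhds.sub (hpow.const_mul a'))
        (by simp)).norm
    -- The term ratios tend to a in the limit; the midpoint between |a| and 1 serves in the ratio
    -- test.
    have hlt : ‖(a - 0) / (1 - a' * 0)‖ < (1 + ‖a‖) / 2 := by
      rw [sub_zero, mul_zero, sub_zero, div_one]
      linarith
    refine summable_of_ratio_norm_eventually_le (r := (1 + ‖a‖) / 2) (by linarith) ?_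
    filter_upwards [hr.eventually_lt_const hlt] with n hn
    rw [ht_succ, norm_mul]
    exact mul_le_mul_of_nonneg_right hn.le (norm_nonneg _)
  have hterm : ∀ n : ℕ, (m 1 - m 0) * t n = m ((n + 1 : ℕ) : ℤ) - m (n : ℤ) := by
    intro n
    induction n with
    | zero => simp [ht, qPoch_zero]
    | succ n ih =>
      have h := hm ((n + 1 : ℕ) : ℤ)
      rw [zpow_natCast] at h
      rw [ht_succ, mul_left_comm, ih, div_mul_eq_mul_div, div_eq_iff (hne (n + 1))]
      push_cast at h ⊢
      rw [add_sub_cancel_right] at h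
      linear_combination -h
  have h1 : HasSum (fun n => (m 1 - m 0) * t n) ((m 1 - m 0) * ∑' n, t n) :=
    hsum.hasSum.mul_left _
  have h2 := h1.tendsto_sum_nat
  simp_rw [hterm] at h2
  have h3 : ∀ N : ℕ, ∑ n ∈ Finset.range N, (m ((n + 1 : ℕ) : ℤ) - m (n : ℤ)) = m N - m 0 :=
    fun N => Finset.sum_range_sub (fun n : ℕ => m (n : ℤ)) N
  simp_rw [h3] at h2
  have h4 := hlim.sub_const (m 0)
  rw [zero_sub] at h4
  exact tendsto_nhds_unique h2 h4

/-! ### Maximal parameter sequences -/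

/-- A criterion for a parameter sequence to be the maximal one: the solution of the recurrence
`T_{n+2} = 2 T_{n+1} - 4 d_{n+1} T_n` that starts with `1, 2` dominates the one given by the
parameter sequence. -/
lemma isMaximalParameterSeq_of_unbounded {d M T : ℕ → ℝ} (hM : IsParameterSeq d M)
    (hM0 : 0 < M 0) (hT0 : T 0 = 1) (hT1 : T 1 = 2)
    (hT : ∀ n, T (n + 2) = 2 * T (n + 1) - 4 * d (n + 1) * T n)
    (hunb : ∀ C : ℝ, ∃ n, C * ∏ i ∈ Finset.range n, 2 * (1 - M i) < T n) :
    IsMaximalParameterSeq d M := by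
  refine ⟨hM, fun g hg => ?_⟩
  by_contra! hex
  obtain ⟨N, hN⟩ := hex
  have hlt1 : ∀ {g : ℕ → ℝ}, IsParameterSeq d g → ∀ n, g n < 1 := by
    intro g hg n
    rcases n with _ | n
    · exact hg.2.1
    · exact (hg.2.2 n).2.1
  -- Since (1 - g_n) g_{n+1} = (1 - M_n) M_{n+1}, an excess at n + 1 forces one at n, hence at 0.
  have hback : ∀ n, M n < g n → M 0 < g 0 := by
    intro n
    induction n with
    | zero => exact id
    | succ n ih =>
      intro h
      refine ih ?_
      by_contra! hle
      have h1 := (hg.2.2 n).2.2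
      have h2 := (hM.2.2 n).2.2
      have h3 := (hM.2.2 n).1
      have h4 := hlt1 hM n
      nlinarith
  have h0 : M 0 < g 0 := hback N hN
  have hrec : ∀ {g : ℕ → ℝ}, IsParameterSeq d g → ∀ n,
      ∏ i ∈ Finset.range (n + 2), 2 * (1 - g i) =
        2 * ∏ i ∈ Finset.range (n + 1), 2 * (1 - g i) -
          4 * d (n + 1) * ∏ i ∈ Finset.range n, 2 * (1 - g i) := by
    intro g hg n
    rw [Finset.prod_range_succ, Finset.prod_range_succ, (hg.2.2 n).2.2]
    ring
  -- The products for `g`, those for `M` and `T` solve one second-order linear recurrence; this β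
  -- matches the values at n = 0 and n = 1 in `hcomb`.
  set β : ℝ := (g 0 - M 0) / M 0 with hβ
  have hβ0 : 0 < β := div_pos (sub_pos.mpr h0) hM0
  have hcomb : ∀ n, ∏ i ∈ Finset.range n, 2 * (1 - g i) =
      (1 + β) * ∏ i ∈ Finset.range n, 2 * (1 - M i) - β * T n := by
    have hpair : ∀ n, (∏ i ∈ Finset.range n, 2 * (1 - g i) =
        (1 + β) * ∏ i ∈ Finset.range n, 2 * (1 - M i) - β * T n) ∧
        ∏ i ∈ Finset.range (n + 1), 2 * (1 - g i) =
        (1 + β) * ∏ i ∈ Finset.range (n + 1), 2 * (1 - M i) - β * T (n + 1) := by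
      intro n
      induction n with
      | zero =>
        have : β * M 0 = g 0 - M 0 := div_mul_cancel₀ _ hM0.ne'
        simp only [Finset.prod_range_zero, zero_add, Finset.prod_range_one, hT0, hT1]
        exact ⟨by ring, by linear_combination 2 * this⟩
      | succ n ih =>
        refine ⟨ih.2, ?_⟩
        rw [hrec hg, hrec hM, hT, ih.1, ih.2]
        ring
    exact fun n => (hpair n).1
  obtain ⟨n, hn⟩ := hunb ((1 + β) / β)
  have hpos : 0 < ∏ i ∈ Finset.range n, 2 * (1 - g i) :=
    Finset.prod_pos fun i _ => by linarith [hlt1 hg i]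
  rw [hcomb] at hpos
  rw [div_mul_eq_mul_div, div_lt_iff₀ hβ0] at hn
  linarith

/-! ### Measures with `q`-hypergeometric moments -/

/-- The finite `q`-shifted factorial of a real number. -/
def qPochReal (a q : ℝ) (n : ℕ) : ℝ := ∏ i ∈ Finset.range n, (1 - a * q ^ i)

lemma qPoch_ofReal (a q : ℝ) (n : ℕ) : qPoch (a : ℂ) q n = (qPochReal a q n : ℂ) := by
  simp [qPoch, qPochReal]

lemma qPochReal_succ (a q : ℝ) (n : ℕ) :
    qPochReal a q (n + 1) = qPochReal a q n * (1 - a * q ^ n) := by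
  simp [qPochReal, Finset.prod_range_succ]

lemma one_sub_mul_pow_pos {q a : ℝ} (hq0 : 0 < q) (hq1 : q < 1) (ha : a < 1) (n : ℕ) :
    0 < 1 - a * q ^ n := by
  nlinarith [pow_le_one₀ hq0.le hq1.le (n := n), pow_pos hq0 n]

lemma qPochReal_pos {q a : ℝ} (hq0 : 0 < q) (hq1 : q < 1) (ha : a < 1) (n : ℕ) :
    0 < qPochReal a q n :=
  Finset.prod_pos fun i _ => one_sub_mul_pow_pos hq0 hq1 ha i

lemma conj_qPoch (a : ℂ) (q : ℝ) (n : ℕ) : conj (qPoch a q n) = qPoch (conj a) q n := by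
  simp [qPoch]

lemma one_sub_mul_pow_ne_zero {q : ℝ} (hq0 : 0 < q) (hq1 : q < 1) {a : ℂ} (ha : ‖a‖ < 1) (n : ℕ) :
    1 - a * (q : ℂ) ^ n ≠ 0 := by
  intro h0
  have h1 : a * (q : ℂ) ^ n = 1 := by linear_combination -h0
  have h2 := one_sub_mul_pow_pos hq0 hq1 ha n
  have h3 : ‖a * (q : ℂ) ^ n‖ = ‖a‖ * q ^ n := by
    rw [norm_mul, norm_pow, Complex.norm_real, Real.norm_of_nonneg hq0.le]
  rw [h1, norm_one] at h3
  linarith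

lemma one_sub_pow_succ_ne_zero {q : ℝ} (hq0 : 0 < q) (hq1 : q < 1) (n : ℕ) :
    1 - (q : ℂ) ^ (n + 1) ≠ 0 := by
  have := one_sub_mul_pow_ne_zero hq0 hq1 (a := q)
    (by rwa [Complex.norm_real, Real.norm_of_nonneg hq0.le]) n
  rwa [← pow_succ'] at this

/-- A positive definite measure on the unit circle whose moments satisfy the same recurrence as
those of `|(qζ; q)_∞|² / |(aζ; q)_∞|²`. -/
structure IsQUltraMeasure (q : ℝ) (a : ℂ) (μ : Measure Circle) : Prop where
  q_pos : 0 < q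
  q_lt_one : q < 1
  norm_lt_one : ‖a‖ < 1
  finite : IsFiniteMeasure μ
  recurrence : ∀ n : ℤ, (1 - conj a * (q : ℂ) ^ n) * (circMoment μ (n + 1) - circMoment μ n) =
    (a - (q : ℂ) ^ n) * (circMoment μ n - circMoment μ (n - 1))
  pos : ∀ f : ℂ[X], f ≠ 0 → 0 < (ip μ f f).re

namespace IsQUltraMeasure

variable {q : ℝ} {a : ℂ} {μ : Measure Circle}

lemma re_lt_one (h : IsQUltraMeasure q a μ) : a.re < 1 :=
  (Complex.re_le_norm a).trans_lt h.norm_lt_one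

lemma ne_a (h : IsQUltraMeasure q a μ) (n : ℕ) : 1 - a * (q : ℂ) ^ n ≠ 0 :=
  one_sub_mul_pow_ne_zero h.q_pos h.q_lt_one h.norm_lt_one n

lemma ne_conj (h : IsQUltraMeasure q a μ) (n : ℕ) : 1 - conj a * (q : ℂ) ^ n ≠ 0 :=
  one_sub_mul_pow_ne_zero h.q_pos h.q_lt_one (by rw [Complex.norm_conj]; exact h.norm_lt_one) n

lemma ne_q (h : IsQUltraMeasure q a μ) (n : ℕ) : 1 - (q : ℂ) ^ (n + 1) ≠ 0 :=
  one_sub_pow_succ_ne_zero h.q_pos h.q_lt_one n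

lemma qPoch_a_ne_zero (h : IsQUltraMeasure q a μ) (n : ℕ) : qPoch a q n ≠ 0 :=
  qPoch_ne_zero h.ne_a n

lemma qPoch_conj_ne_zero (h : IsQUltraMeasure q a μ) (n : ℕ) : qPoch (conj a) q n ≠ 0 :=
  qPoch_ne_zero h.ne_conj n

lemma qPochReal_q_pos (h : IsQUltraMeasure q a μ) (n : ℕ) : 0 < qPochReal q q n :=
  qPochReal_pos h.q_pos h.q_lt_one h.q_lt_one n

lemma normSq_lt_one (h : IsQUltraMeasure q a μ) : Complex.normSq a < 1 := by
  rw [Complex.normSq_eq_norm_sq]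
  exact pow_lt_one₀ (norm_nonneg _) h.norm_lt_one two_ne_zero

lemma qBinomCoeff_ne_zero (h : IsQUltraMeasure q a μ) (n : ℕ) : qBinomCoeff a q n ≠ 0 :=
  div_ne_zero (h.qPoch_a_ne_zero n) (qPoch_self_ne_zero h.ne_q n)

lemma ip_one_sub_X_mul_eq_zero (h : IsQUltraMeasure q a μ) (j l : ℕ) :
    ip μ (Polynomial.X ^ (j + 1)) ((1 - Polynomial.X) * qUltraPoly a (conj a) q (j + 1 + l)) =
      0 := by
  have := h.finite
  rw [ip_X_pow_one_sub_X_mul_qUltraPoly]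
  exact_mod_cast qUltraConv_eq_zero (by exact_mod_cast h.q_pos.ne') h.ne_q h.ne_a
    (u := fun n => circMoment μ n - circMoment μ (n - 1))
    (fun n => by rw [add_sub_cancel_right]; exact h.recurrence n) j l

/-- The common inner product of `qUltraPoly a (conj a) q k` with `1, X, …, X^k`. -/
def kernelMass (_ : IsQUltraMeasure q a μ) (k : ℕ) : ℂ := ip μ 1 (qUltraPoly a (conj a) q k)

/-- Orthogonality of (1 - X) P_k to X^(j+1) says that the inner products of P_k with X^(j+1) and
with X^j agree. -/
lemma ip_X_pow (h : IsQUltraMeasure q a μ) {j k : ℕ} (hj : j ≤ k) :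
    ip μ (Polynomial.X ^ j) (qUltraPoly a (conj a) q k) = h.kernelMass k := by
  have := h.finite
  induction j with
  | zero => rw [pow_zero, kernelMass]
  | succ j ih =>
    obtain ⟨l, rfl⟩ : ∃ l, k = j + 1 + l := ⟨k - (j + 1), by omega⟩
    have h1 := h.ip_one_sub_X_mul_eq_zero j l
    rw [sub_mul, one_mul, ip_sub_right, ip_X_pow_succ_X_mul, ih (by omega)] at h1
    linear_combination h1

/-- Pairing the three-term recurrence with X rather than 1 lets the factors X cancel; the
coefficients with a and conj a then add up to a real one. -/
lemma kernelMass_add_two (h : IsQUltraMeasure q a μ) (k : ℕ) :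
    (1 - (q : ℂ) ^ (k + 2)) * h.kernelMass (k + 2) =
      2 * (1 - a.re * (q : ℂ) ^ (k + 1)) * h.kernelMass (k + 1) -
        (1 - Complex.normSq a * (q : ℂ) ^ k) * h.kernelMass k := by
  have := h.finite
  have h1 := congrArg (ip μ (Polynomial.X ^ (0 + 1))) (qUltraPoly_add_two h.ne_q a (conj a) k)
  rw [ip_sub_right, ip_add_right, ip_C_mul_right, ip_C_mul_right, ip_C_mul_right, ip_C_mul_right,
    ip_X_pow_succ_X_mul, ip_X_pow_succ_X_mul, h.ip_X_pow (by omega), h.ip_X_pow (by omega),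
    h.ip_X_pow (by omega), h.ip_X_pow (by omega), Complex.mul_conj] at h1
  have h2 := Complex.add_conj a
  push_cast at h2
  linear_combination h1 - (q : ℂ) ^ (k + 1) * h.kernelMass (k + 1) * h2

/-- The first difference of the moments. -/
lemma exists_circMoment_sub (h : IsQUltraMeasure q a μ) :
    ∃ v : ℝ, 0 < v ∧ circMoment μ 1 - circMoment μ 0 = -(v : ℂ) * (1 - a) := by
  have := h.finite
  have h0 := h.recurrence 0
  have hm1 : conj (circMoment μ 1) = circMoment μ (-1) := conj_circMoment μ 1
  have hm0 : conj (circMoment μ 0) = circMoment μ 0 := by simpa using conj_circMoment μ 0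
  have ha : 1 - a ≠ 0 := by simpa using h.ne_a 0
  have ha' : 1 - conj a ≠ 0 := by simpa using h.ne_conj 0
  rw [zpow_zero, mul_one, zero_add, zero_sub, ← hm1] at h0
  set w := -(circMoment μ 1 - circMoment μ 0) / (1 - a) with hw
  have hw1 : circMoment μ 1 - circMoment μ 0 = -w * (1 - a) := by
    rw [hw]
    field_simp
  -- The recurrence at n = 0 together with the Hermitian symmetry of the moments forces the quotient
  -- to be real.
  have hconj : conj w = w := by
    have h2 := congrArg conj hw1
    rw [map_sub, map_mul, map_neg, map_sub, map_one, hm0] at h2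
    have h3 : (1 - conj a) * (1 - a) * (conj w - w) = 0 := by
      rw [hw1, show circMoment μ 0 - conj (circMoment μ 1) = conj w * (1 - conj a) by
        linear_combination -h2] at h0
      linear_combination h0
    have := (mul_eq_zero.mp h3).resolve_left (mul_ne_zero ha' ha)
    exact sub_eq_zero.mp this
  obtain ⟨v, hv⟩ := Complex.conj_eq_iff_real.mp hconj
  refine ⟨v, ?_, by rw [hw1, hv]⟩
  -- The squared norm of 1 - X is 2v(1 - Re a), which gives the sign of v.
  have hp := h.pos (1 - Polynomial.X) (by
    intro h0
    have := congrArg (Polynomial.eval 0) h0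
    simp at this)
  have e00 : ip μ 1 1 = circMoment μ 0 := by simpa using ip_X_pow_X_pow μ 0 0
  have e01 : ip μ 1 Polynomial.X = circMoment μ (-1) := by simpa using ip_X_pow_X_pow μ 1 0
  have e10 : ip μ Polynomial.X 1 = circMoment μ 1 := by simpa using ip_X_pow_X_pow μ 0 1
  have e11 : ip μ Polynomial.X Polynomial.X = circMoment μ 0 := by
    simpa using ip_X_pow_X_pow μ 1 1
  have hexp : ip μ (1 - Polynomial.X) (1 - Polynomial.X) =
      -(circMoment μ 1 - circMoment μ 0) - conj (circMoment μ 1 - circMoment μ 0) := by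
    rw [ip_sub_right, ip_sub_left, ip_sub_left, e00, e01, e10, e11, map_sub, hm0, hm1]
    ring
  rw [hexp, hw1, hv] at hp
  simp at hp
  have := h.re_lt_one
  nlinarith

/-- Pairing (1 - X) times the three-term recurrence with X^(k+2) kills two of its terms by
orthogonality, leaving a first-order recurrence in k. -/
lemma ip_boundary (h : IsQUltraMeasure q a μ) {v : ℝ}
    (hv : circMoment μ 1 - circMoment μ 0 = -(v : ℂ) * (1 - a)) (k : ℕ) :
    ip μ (Polynomial.X ^ (k + 1)) ((1 - Polynomial.X) * qUltraPoly a (conj a) q k) *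
        qPoch (conj a) q (k + 1) =
      -(v : ℂ) * (1 - a) * (1 - conj a) * qPochReal (Complex.normSq a) q k := by
  have := h.finite
  induction k with
  | zero =>
    rw [ip_X_pow_one_sub_X_mul_qUltraPoly]
    simp [qUltraConv, qBinomCoeff_zero, qPoch, qPochReal, hv]
  | succ k ih =>
    have h1 := congrArg (fun p => ip μ (Polynomial.X ^ (k + 1 + 1)) ((1 - Polynomial.X) * p))
      (qUltraPoly_add_two h.ne_q a (conj a) k)
    simp only [mul_sub, mul_add, mul_left_comm (1 - Polynomial.X : ℂ[X])] at h1
    rw [ip_sub_right, ip_add_right, ip_C_mul_right, ip_C_mul_right, ip_C_mul_right,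
      ip_C_mul_right, ip_X_pow_succ_X_mul, ip_X_pow_succ_X_mul,
      h.ip_one_sub_X_mul_eq_zero (k + 1) 0, Complex.mul_conj] at h1
    have h2 := h.ip_one_sub_X_mul_eq_zero k 0
    rw [add_zero] at h2
    rw [h2] at h1
    rw [qPoch_succ, qPochReal_succ]
    push_cast
    linear_combination -qPoch (conj a) q (k + 1) * h1 + (1 - Complex.normSq a * (q : ℂ) ^ k) * ih

end IsQUltraMeasure

/-! ### Positivity of the kernel masses and the monic orthogonal polynomials. -/

namespace IsQUltraMeasure

variable {q : ℝ} {a : ℂ} {μ : Measure Circle}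

lemma kernelMass_zero (h : IsQUltraMeasure q a μ) : h.kernelMass 0 = circMoment μ 0 := by
  rw [kernelMass, qUltraPoly_zero]
  simpa using ip_X_pow_X_pow μ 0 0

/-- The term with v separates the masses from the values at 1: those solve the same recurrence, but
start without it (`valueAtOne_one`). -/
lemma kernelMass_one (h : IsQUltraMeasure q a μ) {v : ℝ}
    (hv : circMoment μ 1 - circMoment μ 0 = -(v : ℂ) * (1 - a)) :
    (1 - (q : ℂ)) * h.kernelMass 1 =
      2 * (1 - a.re) * h.kernelMass 0 - v * Complex.normSq (1 - a) := by
  have := h.finite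
  have h1 := congrArg (ip μ 1) (qUltraPoly_one h.ne_q a (conj a))
  have e00 : ip μ 1 1 = circMoment μ 0 := by simpa using ip_X_pow_X_pow μ 0 0
  have e01 : ip μ 1 Polynomial.X = circMoment μ (-1) := by simpa using ip_X_pow_X_pow μ 1 0
  have hm1 : conj (circMoment μ 1) = circMoment μ (-1) := conj_circMoment μ 1
  have hm0 : conj (circMoment μ 0) = circMoment μ 0 := by simpa using conj_circMoment μ 0
  have hv' := congrArg conj hv
  rw [map_sub, map_mul, map_neg, map_sub, map_one, hm0, hm1, Complex.conj_ofReal] at hv'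
  rw [← mul_one (Polynomial.C (1 - conj a)), ip_add_right, ip_C_mul_right, ip_C_mul_right,
    ip_C_mul_right, e00, e01] at h1
  have h2 := Complex.add_conj a
  push_cast at h2
  rw [kernelMass_zero, ← Complex.mul_conj, map_sub, map_one]
  rw [kernelMass]
  linear_combination h1 + (1 - a) * hv' - circMoment μ 0 * h2

lemma circMoment_zero_re_pos (h : IsQUltraMeasure q a μ) : 0 < (circMoment μ 0).re := by
  have h1 := h.pos 1 one_ne_zero
  have e00 : ip μ 1 1 = circMoment μ 0 := by simpa using ip_X_pow_X_pow μ 0 0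
  rwa [e00] at h1

lemma conj_kernelMass (h : IsQUltraMeasure q a μ) (k : ℕ) :
    conj (h.kernelMass k) = h.kernelMass k := by
  have hpair : ∀ k, conj (h.kernelMass k) = h.kernelMass k ∧
      conj (h.kernelMass (k + 1)) = h.kernelMass (k + 1) := by
    intro k
    induction k with
    | zero =>
      have h0 : conj (h.kernelMass 0) = h.kernelMass 0 := by
        rw [kernelMass_zero]
        simpa using conj_circMoment μ 0
      refine ⟨h0, ?_⟩
      obtain ⟨v, -, hv⟩ := h.exists_circMoment_sub
      have h1 := h.kernelMass_one hv
      have h2 := congrArg conj h1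
      simp only [map_mul, map_sub, map_one, Complex.conj_ofReal, map_ofNat, h0] at h2
      rw [← h1] at h2
      have h3 : 1 - (q : ℂ) ≠ 0 := by simpa using h.ne_q 0
      exact mul_left_cancel₀ h3 h2
    | succ k ih =>
      refine ⟨ih.2, ?_⟩
      have h1 := h.kernelMass_add_two k
      have h2 := congrArg conj h1
      simp only [map_mul, map_sub, map_one, map_pow, Complex.conj_ofReal, map_ofNat, ih.1,
        ih.2] at h2
      rw [← h1] at h2
      exact mul_left_cancel₀ (h.ne_q (k + 1)) h2
  exact (hpair k).1

/-- The real number equal to `kernelMass`. -/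
def mass (h : IsQUltraMeasure q a μ) (k : ℕ) : ℝ := (h.kernelMass k).re

lemma ofReal_mass (h : IsQUltraMeasure q a μ) (k : ℕ) : (h.mass k : ℂ) = h.kernelMass k :=
  Complex.conj_eq_iff_re.mp (h.conj_kernelMass k)

lemma mass_zero (h : IsQUltraMeasure q a μ) : (h.mass 0 : ℂ) = circMoment μ 0 := by
  rw [ofReal_mass, kernelMass_zero]

lemma mass_add_two (h : IsQUltraMeasure q a μ) (k : ℕ) :
    (1 - q ^ (k + 2)) * h.mass (k + 2) =
      2 * (1 - a.re * q ^ (k + 1)) * h.mass (k + 1) -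
        (1 - Complex.normSq a * q ^ k) * h.mass k := by
  have h1 := h.kernelMass_add_two k
  simp only [← ofReal_mass] at h1
  exact_mod_cast h1

/-- The monic orthogonal polynomials. -/
def monicPoly (h : IsQUltraMeasure q a μ) : ℕ → ℂ[X]
  | 0 => 1
  | k + 1 => Polynomial.C (qBinomCoeff a q (k + 1))⁻¹ * (qUltraPoly a (conj a) q (k + 1) -
      Polynomial.C ((h.mass (k + 1) : ℂ) / h.mass k) * qUltraPoly a (conj a) q k)

lemma degree_monicPoly_le (h : IsQUltraMeasure q a μ) (k : ℕ) : (h.monicPoly k).degree ≤ k := by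
  rw [Polynomial.degree_le_iff_coeff_zero]
  intro m hm
  have hm : k < m := by exact_mod_cast hm
  rcases k with _ | k
  · rw [monicPoly, Polynomial.coeff_one, if_neg hm.ne']
  · rw [monicPoly, Polynomial.coeff_C_mul, Polynomial.coeff_sub, Polynomial.coeff_C_mul,
      coeff_qUltraPoly_of_lt _ _ _ hm, coeff_qUltraPoly_of_lt _ _ _ (by omega)]
    ring

lemma coeff_monicPoly (h : IsQUltraMeasure q a μ) (k : ℕ) : (h.monicPoly k).coeff k = 1 := by
  rcases k with _ | k
  · simp [monicPoly]
  · rw [monicPoly, Polynomial.coeff_C_mul, Polynomial.coeff_sub, Polynomial.coeff_C_mul,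
      coeff_qUltraPoly_of_lt _ _ _ (Nat.lt_succ_self k), coeff_qUltraPoly, if_pos le_rfl,
      Nat.sub_self, qBinomCoeff_zero]
    have := h.qBinomCoeff_ne_zero (k + 1)
    field_simp
    ring

lemma monic_monicPoly (h : IsQUltraMeasure q a μ) (k : ℕ) : (h.monicPoly k).Monic :=
  Polynomial.monic_of_degree_le k (h.degree_monicPoly_le k) (h.coeff_monicPoly k)

lemma natDegree_monicPoly (h : IsQUltraMeasure q a μ) (k : ℕ) : (h.monicPoly k).natDegree = k :=
  Polynomial.natDegree_eq_of_le_of_coeff_ne_zero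
    (Polynomial.natDegree_le_of_degree_le (h.degree_monicPoly_le k))
    (by rw [coeff_monicPoly]; exact one_ne_zero)

lemma ip_X_pow_monicPoly (h : IsQUltraMeasure q a μ) {k : ℕ} (hk : h.mass k ≠ 0) {j : ℕ}
    (hj : j ≤ k) : ip μ (Polynomial.X ^ j) (h.monicPoly (k + 1)) = 0 := by
  have := h.finite
  rw [monicPoly, ip_C_mul_right, ip_sub_right, ip_C_mul_right, h.ip_X_pow (hj.trans k.le_succ),
    h.ip_X_pow hj, ← ofReal_mass, ← ofReal_mass,
    div_mul_cancel₀ _ (Complex.ofReal_ne_zero.mpr hk), sub_self, mul_zero]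

lemma ip_eq_zero_of_natDegree_le (h : IsQUltraMeasure q a μ) {k : ℕ} (hk : h.mass k ≠ 0)
    {f : ℂ[X]} (hf : f.natDegree ≤ k) : ip μ f (h.monicPoly (k + 1)) = 0 := by
  have := h.finite
  rw [ip_eq_conj_eval_one_mul (fun i hi => h.ip_X_pow_monicPoly hk hi) hf, mul_zero]

/-- The norm is the inner product with X^(k+1). There P_{k+1} contributes s_{k+1} and P_k
contributes s_k plus the boundary product, so only the latter remains. Only s_k ≠ 0 is assumed, so
that positivity of s_{k+1} can be deduced from it. -/
lemma ip_self_monicPoly_succ (h : IsQUltraMeasure q a μ) {v : ℝ}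
    (hv : circMoment μ 1 - circMoment μ 0 = -(v : ℂ) * (1 - a)) {k : ℕ} (hk : h.mass k ≠ 0) :
    ip μ (h.monicPoly (k + 1)) (h.monicPoly (k + 1)) *
        (qPoch a q (k + 1) * qPoch (conj a) q (k + 1)) * h.mass k =
      v * Complex.normSq (1 - a) * qPochReal q q (k + 1) *
        qPochReal (Complex.normSq a) q k * h.mass (k + 1) := by
  have := h.finite
  have hk' : (h.mass k : ℂ) ≠ 0 := Complex.ofReal_ne_zero.mpr hk
  have h0 : ip μ (h.monicPoly (k + 1) - Polynomial.X ^ (k + 1)) (h.monicPoly (k + 1)) = 0 := by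
    refine h.ip_eq_zero_of_natDegree_le hk ?_
    rw [Polynomial.natDegree_le_iff_coeff_eq_zero]
    intro m hm
    rw [Polynomial.coeff_sub, Polynomial.coeff_X_pow]
    split_ifs with hmk
    · rw [hmk, coeff_monicPoly, sub_self]
    · rw [Polynomial.coeff_eq_zero_of_natDegree_lt
        (by rw [natDegree_monicPoly]; omega), sub_zero]
  rw [ip_sub_left, sub_eq_zero] at h0
  have h1 : ip μ (Polynomial.X ^ (k + 1)) (qUltraPoly a (conj a) q k) =
      ip μ (Polynomial.X ^ (k + 1)) ((1 - Polynomial.X) * qUltraPoly a (conj a) q k) +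
        h.mass k := by
    rw [sub_mul, one_mul, ip_sub_right, ip_X_pow_succ_X_mul, h.ip_X_pow le_rfl, ofReal_mass]
    ring
  have h2 := h.ip_boundary hv k
  set D := ip μ (Polynomial.X ^ (k + 1)) ((1 - Polynomial.X) * qUltraPoly a (conj a) q k) with hD
  have h3 : ip μ (h.monicPoly (k + 1)) (h.monicPoly (k + 1)) =
      (qBinomCoeff a q (k + 1))⁻¹ * (-((h.mass (k + 1) : ℂ) / h.mass k * D)) := by
    rw [h0]
    nth_rewrite 1 [monicPoly]
    rw [ip_C_mul_right, ip_sub_right, ip_C_mul_right, h1, h.ip_X_pow le_rfl, ← ofReal_mass]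
    field_simp
    ring
  have h4 := h.qPoch_a_ne_zero (k + 1)
  have h5 := qPoch_self_ne_zero h.ne_q (k + 1)
  rw [h3, ← Complex.mul_conj, map_sub, map_one, qBinomCoeff, ← qPoch_ofReal q q (k + 1)]
  field_simp
  linear_combination -(h.mass (k + 1) : ℂ) * h2

lemma qPoch_mul_conj (a : ℂ) (q : ℝ) (k : ℕ) :
    qPoch a q k * qPoch (conj a) q k = (Complex.normSq (qPoch a q k) : ℂ) := by
  rw [← conj_qPoch, Complex.mul_conj]

/-- In the norm formula every other factor is positive once s_k is, so s_{k+1} inherits the sign of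
a squared norm. -/
lemma mass_pos (h : IsQUltraMeasure q a μ) (k : ℕ) : 0 < h.mass k := by
  induction k with
  | zero =>
    have h1 := h.circMoment_zero_re_pos
    rwa [← mass_zero, Complex.ofReal_re] at h1
  | succ k ih =>
    obtain ⟨v, hv0, hv⟩ := h.exists_circMoment_sub
    have h1 := h.ip_self_monicPoly_succ hv ih.ne'
    have h2 := h.pos _ (h.monic_monicPoly (k + 1)).ne_zero
    rw [ip_self, Complex.ofReal_re] at h2
    rw [ip_self, qPoch_mul_conj] at h1
    have h3 : (∫ ζ : Circle, ‖(h.monicPoly (k + 1)).eval (ζ : ℂ)‖ ^ 2 ∂μ) *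
        Complex.normSq (qPoch a q (k + 1)) * h.mass k =
      v * Complex.normSq (1 - a) * qPochReal q q (k + 1) *
        qPochReal (Complex.normSq a) q k * h.mass (k + 1) := by exact_mod_cast h1
    have h4 : 0 < Complex.normSq (qPoch a q (k + 1)) :=
      Complex.normSq_pos.mpr (h.qPoch_a_ne_zero _)
    have h5 : 0 < Complex.normSq (1 - a) := Complex.normSq_pos.mpr (by simpa using h.ne_a 0)
    have h6 := h.qPochReal_q_pos (k + 1)
    have h7 := qPochReal_pos h.q_pos h.q_lt_one h.normSq_lt_one k
    have h8 : 0 < v * Complex.normSq (1 - a) * qPochReal q q (k + 1) *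
        qPochReal (Complex.normSq a) q k := by positivity
    have h9 : 0 < v * Complex.normSq (1 - a) * qPochReal q q (k + 1) *
        qPochReal (Complex.normSq a) q k * h.mass (k + 1) := by
      rw [← h3]
      positivity
    exact (pos_iff_pos_of_mul_pos h9).mp h8

lemma isMonicOPUC_monicPoly (h : IsQUltraMeasure q a μ) : IsMonicOPUC μ h.monicPoly := by
  refine ⟨fun k => ⟨h.monic_monicPoly k, h.natDegree_monicPoly k⟩, fun j k hjk => ?_⟩
  have key : ∀ j k, j < k → ip μ (h.monicPoly j) (h.monicPoly k) = 0 := by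
    intro j k hjk
    obtain ⟨k, rfl⟩ : ∃ l, k = l + 1 := ⟨k - 1, by omega⟩
    exact h.ip_eq_zero_of_natDegree_le (h.mass_pos k).ne' (by rw [natDegree_monicPoly]; omega)
  rcases lt_or_gt_of_ne hjk with hlt | hlt
  · exact key j k hlt
  · rw [← conj_ip, key k j hlt, map_zero]

lemma qUltraPoly_ne_zero (h : IsQUltraMeasure q a μ) (k : ℕ) : qUltraPoly a (conj a) q k ≠ 0 := by
  intro h0
  have h1 := congrArg (fun p => Polynomial.coeff p k) h0
  simp only [coeff_qUltraPoly, le_refl, if_true, Nat.sub_self, qBinomCoeff_zero, mul_one,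
    Polynomial.coeff_zero] at h1
  exact h.qBinomCoeff_ne_zero k h1

/-! ### Values at 1 and the extremal property of the kernel. -/

/-- The value at `1` of `qUltraPoly a (conj a) q k`, as a real number. -/
def valueAtOne (_ : IsQUltraMeasure q a μ) (k : ℕ) : ℝ :=
  ((qUltraPoly a (conj a) q k).eval 1).re

lemma ip_self_qUltraPoly (h : IsQUltraMeasure q a μ) (k : ℕ) :
    ip μ (qUltraPoly a (conj a) q k) (qUltraPoly a (conj a) q k) =
      conj ((qUltraPoly a (conj a) q k).eval 1) * h.mass k := by
  have := h.finite
  rw [ofReal_mass]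
  exact ip_eq_conj_eval_one_mul (fun i hi => h.ip_X_pow hi)
    (Polynomial.natDegree_le_of_degree_le (degree_qUltraPoly_le _ _ _ k))

/-- The squared norm of P_k is the conjugate of P_k(1) times s_k; the norm and s_k ≠ 0 are real, so
P_k(1) is too. -/
lemma ofReal_valueAtOne (h : IsQUltraMeasure q a μ) (k : ℕ) :
    (h.valueAtOne k : ℂ) = (qUltraPoly a (conj a) q k).eval 1 := by
  refine Complex.conj_eq_iff_re.mp ?_
  have h1 := h.ip_self_qUltraPoly k
  have h2 := congrArg conj h1
  rw [conj_ip, map_mul, Complex.conj_conj, Complex.conj_ofReal, h1] at h2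
  exact mul_right_cancel₀ (Complex.ofReal_ne_zero.mpr (h.mass_pos k).ne') h2

lemma valueAtOne_pos (h : IsQUltraMeasure q a μ) (k : ℕ) : 0 < h.valueAtOne k := by
  have h1 := h.pos _ (h.qUltraPoly_ne_zero k)
  rw [h.ip_self_qUltraPoly, ← h.ofReal_valueAtOne, Complex.conj_ofReal, ← Complex.ofReal_mul,
    Complex.ofReal_re] at h1
  exact (pos_iff_pos_of_mul_pos h1).mpr (h.mass_pos k)

lemma valueAtOne_zero (h : IsQUltraMeasure q a μ) : h.valueAtOne 0 = 1 := by
  simp [valueAtOne, qUltraPoly_zero]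

lemma valueAtOne_one (h : IsQUltraMeasure q a μ) :
    (1 - q) * h.valueAtOne 1 = 2 * (1 - a.re) := by
  have h1 := congrArg (Polynomial.eval 1) (qUltraPoly_one h.ne_q a (conj a))
  simp only [Polynomial.eval_mul, Polynomial.eval_add, Polynomial.eval_C, Polynomial.eval_X,
    ← h.ofReal_valueAtOne] at h1
  have h2 := Complex.add_conj a
  have h3 : (1 - (q : ℂ)) * h.valueAtOne 1 = 2 * (1 - a.re) := by
    push_cast at h2
    linear_combination h1 - h2
  exact_mod_cast h3

lemma valueAtOne_add_two (h : IsQUltraMeasure q a μ) (k : ℕ) :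
    (1 - q ^ (k + 2)) * h.valueAtOne (k + 2) =
      2 * (1 - a.re * q ^ (k + 1)) * h.valueAtOne (k + 1) -
        (1 - Complex.normSq a * q ^ k) * h.valueAtOne k := by
  have h1 := congrArg (Polynomial.eval 1) (qUltraPoly_add_two h.ne_q a (conj a) k)
  simp only [Polynomial.eval_mul, Polynomial.eval_add, Polynomial.eval_sub, Polynomial.eval_C,
    Polynomial.eval_X, ← h.ofReal_valueAtOne, Complex.mul_conj] at h1
  have h2 := Complex.add_conj a
  have h3 : (1 - (q : ℂ) ^ (k + 2)) * h.valueAtOne (k + 2) =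
      2 * (1 - a.re * q ^ (k + 1)) * h.valueAtOne (k + 1) -
        (1 - Complex.normSq a * q ^ k) * h.valueAtOne k := by
    push_cast at h2
    linear_combination h1 - (q : ℂ) ^ (k + 1) * h.valueAtOne (k + 1) * h2
  exact_mod_cast h3

/-- The extremal property of the reproducing kernel at `1`, for the polynomial `1 + ⋯ + X^n`. -/
lemma sq_mul_mass_le (h : IsQUltraMeasure q a μ) (n : ℕ) :
    ((n : ℝ) + 1) ^ 2 * h.mass n ≤ (ip μ (∑ i ∈ Finset.range (n + 1), Polynomial.X ^ i)
      (∑ i ∈ Finset.range (n + 1), Polynomial.X ^ i)).re * h.valueAtOne n := by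
  have := h.finite
  set f : ℂ[X] := ∑ i ∈ Finset.range (n + 1), Polynomial.X ^ i with hf
  set g := qUltraPoly a (conj a) q n with hg
  have hV := h.valueAtOne_pos n
  have hfd : f.natDegree ≤ n := by
    refine Polynomial.natDegree_sum_le_of_forall_le _ _ fun i hi => ?_
    rw [Polynomial.natDegree_X_pow]
    exact Nat.lt_succ_iff.mp (Finset.mem_range.mp hi)
  have hfg : ip μ f g = (((n : ℝ) + 1) * h.mass n : ℝ) := by
    rw [ip_eq_conj_eval_one_mul (fun i hi => h.ip_X_pow hi) hfd, hf, Polynomial.eval_finsetSum]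
    simp [ofReal_mass]
  have hgf : ip μ g f = (((n : ℝ) + 1) * h.mass n : ℝ) := by
    rw [← conj_ip, hfg, Complex.conj_ofReal]
  have hgg : ip μ g g = (h.valueAtOne n * h.mass n : ℝ) := by
    rw [hg, h.ip_self_qUltraPoly, ← h.ofReal_valueAtOne, Complex.conj_ofReal, Complex.ofReal_mul]
  -- The Cauchy–Schwarz vector: up to the factor s_n, its coefficients are ⟨g, g⟩ and ⟨g, f⟩.
  set p : ℂ[X] := Polynomial.C (h.valueAtOne n : ℂ) * f - Polynomial.C (((n : ℝ) + 1 : ℝ) : ℂ) * g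
    with hp
  have hpp : 0 ≤ (ip μ p p).re := by
    rw [ip_self, Complex.ofReal_re]
    exact integral_nonneg fun ζ => by positivity
  have hexp : (ip μ p p).re = h.valueAtOne n * (h.valueAtOne n * (ip μ f f).re -
      ((n : ℝ) + 1) ^ 2 * h.mass n) := by
    rw [hp, ip_sub_right, ip_sub_left, ip_sub_left, ip_C_mul_right, ip_C_mul_right,
      ip_C_mul_right, ip_C_mul_right, ip_C_mul_left, ip_C_mul_left, ip_C_mul_left, ip_C_mul_left,
      hfg, hgf, hgg, Complex.conj_ofReal, Complex.conj_ofReal]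
    simp only [Complex.sub_re, Complex.ofReal_re, Complex.mul_re,
      Complex.ofReal_im]
    ring
  rw [hexp] at hpp
  have := nonneg_of_mul_nonneg_right hpp hV
  linarith

/-! ### The chain sequence and maximality of its parameters. -/

/-- The parameters of the chain sequence, in terms of the masses of the kernels. -/
def chainParam (h : IsQUltraMeasure q a μ) (k : ℕ) : ℝ :=
  1 - (1 - q ^ (k + 1)) / (2 * (1 - a.re * q ^ k)) * (h.mass (k + 1) / h.mass k)

lemma one_sub_re_pos (h : IsQUltraMeasure q a μ) (k : ℕ) : 0 < 1 - a.re * q ^ k :=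
  one_sub_mul_pow_pos h.q_pos h.q_lt_one h.re_lt_one k

lemma one_sub_pow_pos (h : IsQUltraMeasure q a μ) (k : ℕ) : 0 < 1 - q ^ (k + 1) := by
  have := one_sub_mul_pow_pos h.q_pos h.q_lt_one h.q_lt_one k
  rwa [← pow_succ'] at this

lemma chainParam_lt_one (h : IsQUltraMeasure q a μ) (k : ℕ) : h.chainParam k < 1 := by
  have h1 := h.one_sub_re_pos k
  have h2 := h.one_sub_pow_pos k
  have h3 := h.mass_pos k
  have h4 := h.mass_pos (k + 1)
  have : 0 < (1 - q ^ (k + 1)) / (2 * (1 - a.re * q ^ k)) * (h.mass (k + 1) / h.mass k) := by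
    positivity
  unfold chainParam
  linarith

/-- The recurrence of the masses, divided by s_{k+1}, expresses the parameter at k + 1 through
s_k/s_{k+1}, which cancels against the ratio in 1 minus the parameter at k. -/
lemma one_sub_chainParam_mul (h : IsQUltraMeasure q a μ) (k : ℕ) :
    (1 - h.chainParam k) * h.chainParam (k + 1) =
      (1 - q ^ (k + 1)) * (1 - Complex.normSq a * q ^ k) /
        (4 * (1 - a.re * q ^ k) * (1 - a.re * q ^ (k + 1))) := by
  have h1 := (h.one_sub_re_pos k).ne'
  have h2 := (h.one_sub_re_pos (k + 1)).ne'
  have h3 := (h.mass_pos k).ne'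
  have h4 := (h.mass_pos (k + 1)).ne'
  have h5 := h.mass_add_two k
  rw [chainParam, chainParam, show k + 1 + 1 = k + 2 from rfl]
  generalize 1 - a.re * q ^ (k + 1) = y at *
  generalize 1 - q ^ (k + 2) = z at *
  generalize 1 - Complex.normSq a * q ^ k = w at *
  field_simp
  linear_combination -4 * (1 - q ^ (k + 1)) * h.mass (k + 1) * h5

lemma chainParam_zero (h : IsQUltraMeasure q a μ) {v : ℝ}
    (hv : circMoment μ 1 - circMoment μ 0 = -(v : ℂ) * (1 - a)) :
    h.chainParam 0 = v * Complex.normSq (1 - a) / (2 * (1 - a.re) * h.mass 0) := by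
  have h1 := h.kernelMass_one hv
  simp only [← ofReal_mass] at h1
  have h2 : (1 - q) * h.mass 1 = 2 * (1 - a.re) * h.mass 0 - v * Complex.normSq (1 - a) := by
    exact_mod_cast h1
  have h3 := (h.one_sub_re_pos 0).ne'
  have h4 := (h.mass_pos 0).ne'
  rw [pow_zero, mul_one] at h3
  rw [chainParam]
  simp only [zero_add, pow_one, pow_zero, mul_one]
  field_simp
  linear_combination -h2

/-- At 0 this is the sign of v; afterwards the chain relation has a positive right side and a
positive first factor. -/
lemma chainParam_pos (h : IsQUltraMeasure q a μ) (k : ℕ) : 0 < h.chainParam k := by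
  rcases k with _ | k
  · obtain ⟨v, hv0, hv⟩ := h.exists_circMoment_sub
    have h1 : 0 < Complex.normSq (1 - a) := Complex.normSq_pos.mpr (by simpa using h.ne_a 0)
    have h2 := h.mass_pos 0
    have h3 := h.one_sub_re_pos 0
    rw [pow_zero, mul_one] at h3
    rw [h.chainParam_zero hv]
    positivity
  · have h1 := h.one_sub_chainParam_mul k
    have h2 := h.one_sub_re_pos k
    have h3 := h.one_sub_re_pos (k + 1)
    have h4 := h.one_sub_pow_pos k
    have h5 := one_sub_mul_pow_pos h.q_pos h.q_lt_one h.normSq_lt_one k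
    have h6 : 0 < (1 - h.chainParam k) * h.chainParam (k + 1) := by
      rw [h1]
      positivity
    exact (pos_iff_pos_of_mul_pos h6).mp (by linarith [h.chainParam_lt_one k])

lemma prod_one_sub_chainParam (h : IsQUltraMeasure q a μ) (n : ℕ) :
    ∏ i ∈ Finset.range n, 2 * (1 - h.chainParam i) =
      qPochReal q q n / qPochReal a.re q n * (h.mass n / h.mass 0) := by
  induction n with
  | zero => simp [qPochReal, (h.mass_pos 0).ne']
  | succ n ih =>
    have h1 := (h.one_sub_re_pos n).ne'
    have h2 := (qPochReal_pos h.q_pos h.q_lt_one h.re_lt_one n).ne'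
    have h3 := (h.mass_pos n).ne'
    have h4 := (h.mass_pos 0).ne'
    rw [Finset.prod_range_succ, ih, qPochReal_succ, qPochReal_succ, chainParam, ← pow_succ']
    field_simp
    ring

/-- If the mass of `|1 + ⋯ + ζ^n|²` grows at most linearly, then the parameters given by the
masses of the kernels form the maximal parameter sequence. -/
lemma isMaximalParameterSeq (h : IsQUltraMeasure q a μ) {d : ℕ → ℝ}
    (hd : ∀ k : ℕ, d (k + 1) = (1 - q ^ (k + 1)) * (1 - Complex.normSq a * q ^ k) /
        (4 * (1 - a.re * q ^ k) * (1 - a.re * q ^ (k + 1))))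
    {B : ℝ} (hB : ∀ n : ℕ, (ip μ (∑ i ∈ Finset.range (n + 1), Polynomial.X ^ i)
      (∑ i ∈ Finset.range (n + 1), Polynomial.X ^ i)).re ≤ B * (n + 1)) :
    IsMaximalParameterSeq d h.chainParam := by
  have hc := fun n => qPochReal_pos h.q_pos h.q_lt_one h.re_lt_one n
  refine isMaximalParameterSeq_of_unbounded
    (T := fun n => qPochReal q q n / qPochReal a.re q n * h.valueAtOne n) ?_ (h.chainParam_pos 0)
    ?_ ?_ ?_ ?_
  · exact ⟨(h.chainParam_pos 0).le, h.chainParam_lt_one 0, fun n => ⟨h.chainParam_pos _,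
      h.chainParam_lt_one _, by rw [one_sub_chainParam_mul, hd]⟩⟩
  · simp [qPochReal, h.valueAtOne_zero]
  · have h1 := h.valueAtOne_one
    have h2 := (h.one_sub_re_pos 0).ne'
    rw [pow_zero, mul_one] at h2
    simp only [qPochReal, Finset.prod_range_one, pow_zero, mul_one]
    rw [div_mul_eq_mul_div, h1]
    field_simp
  · intro n
    have h1 := h.valueAtOne_add_two n
    have h2 := (hc n).ne'
    have h3 := (h.one_sub_re_pos n).ne'
    have h4 := (h.one_sub_re_pos (n + 1)).ne'
    simp only [qPochReal_succ, hd, ← pow_succ', show n + 1 + 1 = n + 2 from rfl]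
    generalize 1 - a.re * q ^ (n + 1) = y at *
    generalize 1 - q ^ (n + 2) = z at *
    generalize 1 - Complex.normSq a * q ^ n = w at *
    field_simp
    linear_combination qPochReal q q n * (1 - q ^ (n + 1)) * h1
  · intro C
    -- The ratio P_n(1)/s_n is at least (n + 1)/B, so it exceeds C/s_0 for this n.
    obtain ⟨n, hn⟩ := exists_nat_gt (B * (C / h.mass 0))
    refine ⟨n, ?_⟩
    have hm := h.mass_pos n
    have hV := h.valueAtOne_pos n
    have h0 := h.mass_pos 0
    have hQ := h.qPochReal_q_pos n
    have h1 := h.sq_mul_mass_le n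
    have h2 : ((n : ℝ) + 1) * h.mass n ≤ B * h.valueAtOne n := by
      have h3 := h1.trans (mul_le_mul_of_nonneg_right (hB n) hV.le)
      have h4 : (0 : ℝ) < n + 1 := by positivity
      nlinarith
    have hBpos : 0 < B := by
      have h3 : 0 < B * h.valueAtOne n := lt_of_lt_of_le (by positivity) h2
      exact (pos_iff_pos_of_mul_pos h3).mpr hV
    rw [prod_one_sub_chainParam, mul_left_comm]
    refine mul_lt_mul_of_pos_left ?_ (div_pos hQ (hc n))
    have h5 : B * (C * (h.mass n / h.mass 0)) < B * h.valueAtOne n := by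
      refine lt_of_lt_of_le ?_ h2
      rw [show B * (C * (h.mass n / h.mass 0)) = B * (C / h.mass 0) * h.mass n by ring]
      exact mul_lt_mul_of_pos_right (by linarith) hm
    exact lt_of_mul_lt_mul_left h5 hBpos.le

end IsQUltraMeasure

/-! ### Explicit polynomials, Verblunsky coefficients and norms. -/

namespace IsQUltraMeasure

variable {q : ℝ} {a : ℂ} {μ : Measure Circle}

lemma qPoch_re_ne_zero (h : IsQUltraMeasure q a μ) (n : ℕ) : qPoch (a.re : ℂ) q n ≠ 0 := by
  rw [qPoch_ofReal]
  exact Complex.ofReal_ne_zero.mpr (qPochReal_pos h.q_pos h.q_lt_one h.re_lt_one n).ne'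

lemma one_sub_re_ne_zero (h : IsQUltraMeasure q a μ) (k : ℕ) :
    1 - (a.re : ℂ) * (q : ℂ) ^ k ≠ 0 := by
  exact_mod_cast (h.one_sub_re_pos k).ne'

lemma eval_monicPoly_succ (h : IsQUltraMeasure q a μ) (k : ℕ) (z : ℂ) :
    (h.monicPoly (k + 1)).eval z = qPoch (a.re : ℂ) q (k + 1) / qPoch a q (k + 1) *
      (qPoch q q (k + 1) / qPoch (a.re : ℂ) q (k + 1) *
          (qUltraPoly a (conj a) q (k + 1)).eval z -
        2 * (1 - (h.chainParam k : ℂ)) * (qPoch q q k / qPoch (a.re : ℂ) q k *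
          (qUltraPoly a (conj a) q k).eval z)) := by
  have h1 := h.qPoch_a_ne_zero (k + 1)
  have h2 := h.qPoch_re_ne_zero k
  have h3 := h.one_sub_re_ne_zero k
  have h4 := qPoch_self_ne_zero h.ne_q (k + 1)
  have h5 : (h.mass k : ℂ) ≠ 0 := Complex.ofReal_ne_zero.mpr (h.mass_pos k).ne'
  rw [monicPoly, Polynomial.eval_C_mul, Polynomial.eval_sub, Polynomial.eval_C_mul, chainParam,
    qBinomCoeff]
  rw [qPoch_succ q q] at h4 ⊢
  rw [qPoch_succ (a.re : ℂ) q]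
  rw [← pow_succ'] at h4 ⊢
  push_cast
  generalize 1 - (q : ℂ) ^ (k + 1) = x at *
  field_simp
  ring

lemma verblunsky_monicPoly (h : IsQUltraMeasure q a μ) (k : ℕ) :
    verblunsky h.monicPoly k = (1 - 2 * (h.chainParam k : ℂ) *
        ((1 - (a.re : ℂ) * (q : ℂ) ^ k) / (1 - conj a * (q : ℂ) ^ k))) *
      (qPoch a q k / qPoch (conj a) q k) := by
  have h0 : ∀ k, qPoch q q k / qPoch (a.re : ℂ) q k * (qUltraPoly a (conj a) q k).eval 0 =
      qPoch (conj a) q k / qPoch (a.re : ℂ) q k := by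
    intro k
    rw [div_mul_eq_mul_div, ← Polynomial.coeff_zero_eq_eval_zero, coeff_qUltraPoly, if_pos (Nat.zero_le k),
      qBinomCoeff_zero, one_mul, Nat.sub_zero, qBinomCoeff,
      mul_div_cancel₀ _ (qPoch_self_ne_zero h.ne_q k)]
  have h1 := h.qPoch_conj_ne_zero k
  have h2 := h.ne_conj k
  have h3 := h.one_sub_re_ne_zero k
  have h4 := h.qPoch_re_ne_zero k
  have h5 := Complex.add_conj a
  push_cast at h5
  rw [verblunsky, eval_monicPoly_succ, h0, h0]
  simp only [map_mul, map_sub, map_div₀, conj_qPoch, Complex.conj_ofReal, Complex.conj_conj,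
    map_one, map_ofNat]
  rw [qPoch_succ, qPoch_succ, qPoch_succ]
  -- This identity rewrites the two constant terms as the form 1 - 2M of the coefficient.
  have h6 : (1 - a * (q : ℂ) ^ k) + (1 - conj a * (q : ℂ) ^ k) =
      2 * (1 - (a.re : ℂ) * (q : ℂ) ^ k) := by
    linear_combination -(q : ℂ) ^ k * h5
  generalize 1 - conj a * (q : ℂ) ^ k = y at *
  generalize 1 - (a.re : ℂ) * (q : ℂ) ^ k = s at *
  field_simp
  linear_combination -qPoch a q k * h6

/-- The chain relation trades s_{k+1}/s_k for the parameter at k + 1, and the parameter at 0 absorbs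
v; no product over the intermediate parameters is left. -/
lemma ip_self_monicPoly (h : IsQUltraMeasure q a μ) (k : ℕ) :
    ip μ (h.monicPoly k) (h.monicPoly k) = h.mass 0 *
      (qPoch q q k * qPoch (Complex.normSq a : ℂ) q k / (qPoch a q k * qPoch (conj a) q k) *
        ((1 - (a.re : ℂ)) / (1 - (a.re : ℂ) * (q : ℂ) ^ k)) *
        ((h.chainParam 0 : ℂ) / (h.chainParam k : ℂ))) := by
  have hc0 : (h.chainParam 0 : ℂ) ≠ 0 := Complex.ofReal_ne_zero.mpr (h.chainParam_pos 0).ne'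
  have hre : 1 - (a.re : ℂ) ≠ 0 := by simpa using h.one_sub_re_ne_zero 0
  rcases k with _ | k
  · have e00 : ip μ 1 1 = circMoment μ 0 := by simpa using ip_X_pow_X_pow μ 0 0
    simp only [monicPoly, e00, mass_zero, qPoch_zero, pow_zero, mul_one, div_one]
    field_simp
  · obtain ⟨v, -, hv⟩ := h.exists_circMoment_sub
    have h1 := h.ip_self_monicPoly_succ hv (h.mass_pos k).ne'
    have h2 := congrArg (Complex.ofReal) (h.chainParam_zero hv)
    have h3 := congrArg (Complex.ofReal) (h.one_sub_chainParam_mul k)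
    have h4 : (1 - (h.chainParam k : ℂ)) * (2 * (1 - (a.re : ℂ) * (q : ℂ) ^ k)) * h.mass k =
        (1 - (q : ℂ) ^ (k + 1)) * h.mass (k + 1) := by
      have e1 := h.one_sub_re_ne_zero k
      have e2 : (h.mass k : ℂ) ≠ 0 := Complex.ofReal_ne_zero.mpr (h.mass_pos k).ne'
      rw [chainParam]
      push_cast
      field_simp
      ring
    have n1 := h.one_sub_re_ne_zero k
    have n2 := h.one_sub_re_ne_zero (k + 1)
    have n3 : (h.mass k : ℂ) ≠ 0 := Complex.ofReal_ne_zero.mpr (h.mass_pos k).ne'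
    have n4 : (h.mass 0 : ℂ) ≠ 0 := Complex.ofReal_ne_zero.mpr (h.mass_pos 0).ne'
    have n5 : (h.chainParam (k + 1) : ℂ) ≠ 0 :=
      Complex.ofReal_ne_zero.mpr (h.chainParam_pos (k + 1)).ne'
    have n6 := h.qPoch_a_ne_zero (k + 1)
    have n7 := h.qPoch_conj_ne_zero (k + 1)
    have n8 := h.ne_q k
    push_cast at h2 h3
    rw [← qPoch_ofReal, ← qPoch_ofReal] at h1
    rw [qPoch_succ (Complex.normSq a : ℂ)]
    have h5 : (h.mass (k + 1) : ℂ) * h.chainParam (k + 1) * (1 - (a.re : ℂ) * (q : ℂ) ^ (k + 1)) * 2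
        = (1 - (Complex.normSq a : ℂ) * (q : ℂ) ^ k) * h.mass k := by
      rw [eq_div_iff (mul_ne_zero (mul_ne_zero (by norm_num : (4 : ℂ) ≠ 0) n1) n2)] at h3
      refine mul_left_cancel₀ (mul_ne_zero n8 two_ne_zero) ?_
      linear_combination 2 * h.mass k * h3 - 4 * (h.chainParam (k + 1) : ℂ) *
        (1 - (a.re : ℂ) * (q : ℂ) ^ (k + 1)) * h4
    have h6 : (h.chainParam 0 : ℂ) * (1 - (a.re : ℂ)) * h.mass 0 * 2 =
        v * Complex.normSq (1 - a) := by
      rw [h2]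
      field_simp
    generalize 1 - (a.re : ℂ) * (q : ℂ) ^ (k + 1) = x at *
    generalize 1 - (Complex.normSq a : ℂ) * (q : ℂ) ^ k = w at *
    have h7 : ip μ (h.monicPoly (k + 1)) (h.monicPoly (k + 1)) =
        v * Complex.normSq (1 - a) * qPoch q q (k + 1) * qPoch (Complex.normSq a : ℂ) q k *
          h.mass (k + 1) / (qPoch a q (k + 1) * qPoch (conj a) q (k + 1) * h.mass k) := by
      rw [eq_div_iff (mul_ne_zero (mul_ne_zero n6 n7) n3)]
      linear_combination h1
    rw [h7, ← h6]
    field_simp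
    linear_combination qPoch q q (k + 1) * qPoch (Complex.normSq a : ℂ) q k * h5

end IsQUltraMeasure

lemma IsMaximalParameterSeq.unique {d M N : ℕ → ℝ} (hM : IsMaximalParameterSeq d M)
    (hN : IsMaximalParameterSeq d N) : M = N :=
  funext fun n => le_antisymm (hN.2 M hM.1 n) (hM.2 N hN.1 n)

/-! ### The parameters -/

lemma conj_cpow_bParam {q : ℝ} (hq0 : 0 < q) (b : ℂ) :
    (q : ℂ) ^ conj b = conj ((q : ℂ) ^ b) := by
  rw [Complex.cpow_conj _ _ (by rw [Complex.arg_ofReal_of_nonneg hq0.le]; exact Real.pi_pos.ne),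
    Complex.conj_ofReal]

lemma re_cpow_bParam {q : ℝ} (hq0 : 0 < q) (lam eta : ℝ) :
    ((q : ℂ) ^ bParam lam eta).re = qcos q lam eta := by
  have hq : (q : ℂ) ≠ 0 := by exact_mod_cast hq0.ne'
  have e : Complex.log q * bParam lam eta =
      ((Real.log q * lam : ℝ) : ℂ) + ((-(eta * Real.log q) : ℝ) : ℂ) * Complex.I := by
    rw [← Complex.ofReal_log hq0.le, bParam]
    push_cast
    ring
  rw [Complex.cpow_def_of_ne_zero hq, e, Complex.exp_add, ← Complex.ofReal_exp,
    Complex.re_ofReal_mul, Complex.exp_ofReal_mul_I_re, Real.cos_neg, qcos,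
    Real.rpow_def_of_pos hq0]

lemma normSq_cpow_bParam {q : ℝ} (hq0 : 0 < q) (lam eta : ℝ) :
    Complex.normSq ((q : ℂ) ^ bParam lam eta) = q ^ (2 * lam) := by
  rw [Complex.normSq_eq_norm_sq, norm_cpow_bParam hq0, ← Real.rpow_natCast, ← Real.rpow_mul hq0.le,
    mul_comm]
  norm_num

section

variable {q lam eta : ℝ}

lemma isQUltraMeasure_muCheck (hq0 : 0 < q) (hq1 : q < 1) (hlam : 0 < lam) {ρ : ℝ} (hρ : 0 < ρ) :
    IsQUltraMeasure q ((q : ℂ) ^ bParam lam eta) (muCheck q lam eta ρ) where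
  q_pos := hq0
  q_lt_one := hq1
  norm_lt_one := norm_cpow_bParam_lt_one hq0 hq1 hlam eta
  finite := isFiniteMeasure_muCheck hq0 hq1 hlam ρ
  recurrence := circMoment_muCheck_recurrence hq0 hq1 hlam hρ
  pos := fun _ hf => ip_self_muCheck_pos hq0 hq1 hlam hρ hf

lemma rpow_mul_cos (hq0 : 0 < q) (k : ℕ) :
    q ^ (lam + (k : ℝ)) * Real.cos (eta * Real.log q) = qcos q lam eta * q ^ k := by
  rw [Real.rpow_add hq0, Real.rpow_natCast, qcos]
  ring

lemma rpow_succ_sub_one_mul_cos (hq0 : 0 < q) (k : ℕ) :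
    q ^ (lam + ((k + 1 : ℕ) : ℝ) - 1) * Real.cos (eta * Real.log q) = qcos q lam eta * q ^ k := by
  rw [← rpow_mul_cos hq0]
  push_cast
  ring_nf

lemma dNext_succ (hq0 : 0 < q) (k : ℕ) :
    dNext q lam eta (k + 1) =
      (1 - q ^ (k + 1)) * (1 - Complex.normSq ((q : ℂ) ^ bParam lam eta) * q ^ k) /
        (4 * (1 - ((q : ℂ) ^ bParam lam eta).re * q ^ k) *
          (1 - ((q : ℂ) ^ bParam lam eta).re * q ^ (k + 1))) := by
  have h1 : q ^ (2 * lam + ((k + 1 : ℕ) : ℝ) - 1) = q ^ (2 * lam) * q ^ k := by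
    rw [← Real.rpow_natCast q k, ← Real.rpow_add hq0]
    push_cast
    ring_nf
  rw [dNext, rpow_succ_sub_one_mul_cos hq0, rpow_mul_cos hq0, h1, re_cpow_bParam hq0,
    normSq_cpow_bParam hq0]

lemma isMaximalParameterSeq_chainParam (hq0 : 0 < q) (hq1 : q < 1) (hlam : 0 < lam) {ρ : ℝ}
    (hρ : 0 < ρ) : IsMaximalParameterSeq (dNext q lam eta)
      (isQUltraMeasure_muCheck (eta := eta) hq0 hq1 hlam hρ).chainParam := by
  obtain ⟨B, hB⟩ := exists_ip_geom_sum_le (eta := eta) hq0 hq1 hlam hρ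
  exact (isQUltraMeasure_muCheck hq0 hq1 hlam hρ).isMaximalParameterSeq (dNext_succ hq0) hB

lemma cpow_ne_zero_of_pos (hq0 : 0 < q) (b : ℂ) : (q : ℂ) ^ b ≠ 0 := by
  rw [Complex.cpow_def_of_ne_zero (by exact_mod_cast hq0.ne')]
  exact Complex.exp_ne_zero _

lemma chainParam_zero_eq_phi21 (hq0 : 0 < q) (hq1 : q < 1) (hlam : 0 < lam) {ρ : ℝ}
    (hρ : 0 < ρ) :
    ((isQUltraMeasure_muCheck (eta := eta) hq0 hq1 hlam hρ).chainParam 0 : ℂ) =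
      1 / 2 * ((1 - (q : ℂ) ^ conj (bParam lam eta)) / (1 - (qcos q lam eta : ℂ))) *
        (1 / phi21 q ((q : ℂ) ^ (-bParam lam eta + 1)) ((q : ℂ) ^ (conj (bParam lam eta) + 1)) q
          ((q : ℂ) ^ bParam lam eta)) := by
  have h := isQUltraMeasure_muCheck (eta := eta) hq0 hq1 hlam hρ
  have hq : (q : ℂ) ≠ 0 := by exact_mod_cast hq0.ne'
  have ha := cpow_ne_zero_of_pos hq0 (bParam lam eta)
  have h1 := mul_phi21_eq_neg hq0 hq1 ha h.norm_lt_one (by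
    rw [Complex.norm_conj]; exact h.norm_lt_one) h.recurrence
    (tendsto_circMoment_muCheck hq0 hq1 hlam hρ)
  obtain ⟨v, hv0, hv⟩ := h.exists_circMoment_sub
  have e1 : (q : ℂ) ^ (-bParam lam eta + 1) = q / (q : ℂ) ^ bParam lam eta := by
    rw [Complex.cpow_add _ _ hq, Complex.cpow_neg, Complex.cpow_one]
    field_simp
  have e2 : (q : ℂ) ^ (conj (bParam lam eta) + 1) = q * conj ((q : ℂ) ^ bParam lam eta) := by
    rw [Complex.cpow_add _ _ hq, Complex.cpow_one, conj_cpow_bParam hq0, mul_comm]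
  rw [e1, e2, conj_cpow_bParam hq0, h.chainParam_zero hv, ← re_cpow_bParam hq0]
  rw [hv, ← h.mass_zero] at h1
  push_cast
  rw [← Complex.mul_conj, map_sub, map_one]
  have n1 : (h.mass 0 : ℂ) ≠ 0 := Complex.ofReal_ne_zero.mpr (h.mass_pos 0).ne'
  have n2 : (v : ℂ) ≠ 0 := Complex.ofReal_ne_zero.mpr hv0.ne'
  have n3 := h.ne_a 0
  have n4 := h.one_sub_re_ne_zero 0
  rw [pow_zero, mul_one] at n3 n4
  generalize phi21 q (q / (q : ℂ) ^ bParam lam eta) (q * conj ((q : ℂ) ^ bParam lam eta)) q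
    ((q : ℂ) ^ bParam lam eta) = φ at *
  -- The series cannot vanish, since its product with c_1 - c_0 is -c_0 ≠ 0; the formula for the
  -- first parameter thus divides by a nonzero number.
  have n5 : φ ≠ 0 := by
    rintro rfl
    rw [mul_zero] at h1
    exact n1 (neg_eq_zero.mp h1.symm)
  have h2 : (h.mass 0 : ℂ) = v * (1 - (q : ℂ) ^ bParam lam eta) * φ := by linear_combination h1
  rw [h2]
  field_simp

lemma Rpoly_eq (hq0 : 0 < q) (hq1 : q < 1) (hlam : 0 < lam) (k : ℕ) (z : ℂ) :
    Rpoly q lam eta k z = qPoch q q k / qPoch (qcos q lam eta : ℂ) q k *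
      (qUltraPoly ((q : ℂ) ^ bParam lam eta) (conj ((q : ℂ) ^ bParam lam eta)) q k).eval z := by
  have hq : (q : ℂ) ≠ 0 := by exact_mod_cast hq0.ne'
  have ha := cpow_ne_zero_of_pos hq0 (bParam lam eta)
  have ha' : conj ((q : ℂ) ^ bParam lam eta) ≠ 0 := (map_ne_zero _).mpr ha
  have e1 : (q : ℂ) ^ (-(k : ℂ)) = ((q : ℂ) ^ k)⁻¹ := by
    rw [Complex.cpow_neg, Complex.cpow_natCast]
  have e2 : (q : ℂ) ^ (-conj (bParam lam eta) - (k : ℂ) + 1) =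
      q / (conj ((q : ℂ) ^ bParam lam eta) * (q : ℂ) ^ k) := by
    rw [Complex.cpow_add _ _ hq, Complex.cpow_sub _ _ hq, Complex.cpow_neg, Complex.cpow_one,
      Complex.cpow_natCast, conj_cpow_bParam hq0]
    field_simp
  have e3 : (q : ℂ) ^ (-conj (bParam lam eta) + 1) = q / conj ((q : ℂ) ^ bParam lam eta) := by
    rw [Complex.cpow_add _ _ hq, Complex.cpow_neg, Complex.cpow_one, conj_cpow_bParam hq0]
    field_simp
  have h1 := qPoch_mul_phi21_terminating hq (one_sub_pow_succ_ne_zero hq0 hq1) ha'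
    (one_sub_mul_pow_ne_zero hq0 hq1 (by
      rw [Complex.norm_conj]; exact norm_cpow_bParam_lt_one hq0 hq1 hlam eta))
    ((q : ℂ) ^ bParam lam eta) z k
  rw [Rpoly, e1, e2, e3, conj_cpow_bParam hq0, div_mul_eq_mul_div, h1, div_mul_eq_mul_div]

end

end QOPUC

end

/-! ### Assembly of the theorem. -/

theorem theorem1p2 (q lam eta : ℝ) (hq0 : 0 < q) (hq1 : q < 1) (hlam : 0 < lam)
    (b : ℂ) (hb : b = bParam lam eta) :
    ∃ M : ℕ → ℝ,
      -- the numbers `M_1, M_2, …` (the value `M 0` plays no role)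
      ((M 1 : ℂ) = 1 / 2 * ((1 - (q : ℂ) ^ conj b) / (1 - (qcos q lam eta : ℂ))) *
          (1 / phi21 q ((q : ℂ) ^ (-b + 1)) ((q : ℂ) ^ (conj b + 1)) q ((q : ℂ) ^ b))) ∧
      (∀ k : ℕ, 1 ≤ k → M (k + 1) = dNext q lam eta k / (1 - M k)) ∧
      IsMaximalParameterSeq (dNext q lam eta) (fun k => M (k + 1)) ∧
      -- the orthogonal polynomials, for every positive normalisation of the measure
      ∀ ρ : ℝ, 0 < ρ →
        ∃ Φ : ℕ → ℂ[X], IsMonicOPUC (muCheck q lam eta ρ) Φ ∧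
          (∀ Ψ : ℕ → ℂ[X], IsMonicOPUC (muCheck q lam eta ρ) Ψ → Ψ = Φ) ∧
          (∀ k : ℕ, 1 ≤ k → ∀ z : ℂ,
            (Φ k).eval z = qPoch (qcos q lam eta : ℂ) q k / qPoch ((q : ℂ) ^ b) q k *
              (Rpoly q lam eta k z - 2 * (1 - (M k : ℂ)) * Rpoly q lam eta (k - 1) z)) ∧
          (∀ k : ℕ, 1 ≤ k →
            verblunsky Φ (k - 1) =
              (1 - 2 * (M k : ℂ) *
                ((1 - ((q ^ (lam + (k : ℝ) - 1) * Real.cos (eta * Real.log q) : ℝ) : ℂ)) /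
                  (1 - (q : ℂ) ^ (conj b + (k : ℂ) - 1)))) *
              (qPoch ((q : ℂ) ^ b) q (k - 1) / qPoch ((q : ℂ) ^ conj b) q (k - 1))) ∧
          -- the normalisation constants, when the measure is a probability measure
          (IsProbabilityMeasure (muCheck q lam eta ρ) →
            ∃ κ : ℕ → ℝ,
              IsOrthonormalOPUC (muCheck q lam eta ρ) κ (fun k => Polynomial.C (κ k : ℂ) * Φ k) ∧
              ∀ k : ℕ, (((κ k) ^ (-2 : ℤ) : ℝ) : ℂ) =
                qPoch q q k * qPoch ((q ^ (2 * lam) : ℝ) : ℂ) q k /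
                    (qPoch ((q : ℂ) ^ b) q k * qPoch ((q : ℂ) ^ conj b) q k) *
                  ((1 - (qcos q lam eta : ℂ)) /
                    (1 - ((q ^ (lam + (k : ℝ)) * Real.cos (eta * Real.log q) : ℝ) : ℂ))) *
                  ((M 1 : ℂ) / (M (k + 1) : ℂ))) := by
  subst hb
  have h1 : IsQUltraMeasure q ((q : ℂ) ^ bParam lam eta) (muCheck q lam eta 1) :=
    isQUltraMeasure_muCheck hq0 hq1 hlam one_pos
  have hre : ((q : ℂ) ^ bParam lam eta).re = qcos q lam eta := re_cpow_bParam hq0 lam eta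
  have hmax1 := isMaximalParameterSeq_chainParam (eta := eta) hq0 hq1 hlam one_pos
  -- The parameters are read off from the measure with ρ = 1 and shifted by one; the value at 0 is
  -- an unused default.
  refine ⟨fun k => h1.chainParam (k - 1), ?_, ?_, hmax1, ?_⟩
  · exact chainParam_zero_eq_phi21 hq0 hq1 hlam one_pos
  · intro k hk
    obtain ⟨k, rfl⟩ : ∃ l, k = l + 1 := ⟨k - 1, by omega⟩
    simp only [Nat.add_sub_cancel]
    rw [dNext_succ hq0, ← h1.one_sub_chainParam_mul k,
      mul_div_cancel_left₀ _ (sub_pos.mpr (h1.chainParam_lt_one k)).ne']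
  · intro ρ hρ
    have h : IsQUltraMeasure q ((q : ℂ) ^ bParam lam eta) (muCheck q lam eta ρ) :=
      isQUltraMeasure_muCheck hq0 hq1 hlam hρ
    have hfin := h.finite
    -- The sequence d does not involve ρ and has at most one maximal parameter sequence, so the
    -- parameters are the same for every ρ.
    have hparam : h1.chainParam = h.chainParam :=
      hmax1.unique (isMaximalParameterSeq_chainParam (eta := eta) hq0 hq1 hlam hρ)
    rw [hparam]
    refine ⟨h.monicPoly, h.isMonicOPUC_monicPoly,
      fun Ψ hΨ => h.isMonicOPUC_monicPoly.unique h.pos hΨ, ?_, ?_, ?_⟩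
    · intro k hk z
      obtain ⟨k, rfl⟩ : ∃ l, k = l + 1 := ⟨k - 1, by omega⟩
      rw [Nat.add_sub_cancel, h.eval_monicPoly_succ, Rpoly_eq hq0 hq1 hlam,
        Rpoly_eq hq0 hq1 hlam, hre]
      simp only [Nat.add_sub_cancel]
    · intro k hk
      obtain ⟨k, rfl⟩ : ∃ l, k = l + 1 := ⟨k - 1, by omega⟩
      have hq : (q : ℂ) ≠ 0 := by exact_mod_cast hq0.ne'
      have e1 : (q : ℂ) ^ (conj (bParam lam eta) + ((k + 1 : ℕ) : ℂ) - 1) =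
          conj ((q : ℂ) ^ bParam lam eta) * (q : ℂ) ^ k := by
        rw [← conj_cpow_bParam hq0, ← Complex.cpow_natCast, ← Complex.cpow_add _ _ hq]
        push_cast
        ring_nf
      rw [Nat.add_sub_cancel, h.verblunsky_monicPoly, e1, rpow_succ_sub_one_mul_cos hq0, hre,
        conj_cpow_bParam hq0]
      push_cast
      rfl
    · intro hprob
      -- The mass at 0 is the total mass of the measure.
      have hmass : (h.mass 0 : ℂ) = 1 := by
        rw [h.mass_zero, circMoment]
        simp
      have hpos : ∀ k, 0 < (ip (muCheck q lam eta ρ) (h.monicPoly k) (h.monicPoly k)).re :=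
        fun k => h.pos _ (h.monic_monicPoly k).ne_zero
      have hreal : ∀ k, (((ip (muCheck q lam eta ρ) (h.monicPoly k) (h.monicPoly k)).re : ℝ) : ℂ) =
          ip (muCheck q lam eta ρ) (h.monicPoly k) (h.monicPoly k) := fun k => by
        rw [ip_self, Complex.ofReal_re]
      refine ⟨fun k => (√(ip (muCheck q lam eta ρ) (h.monicPoly k) (h.monicPoly k)).re)⁻¹,
        ⟨fun k => ⟨inv_pos.mpr (Real.sqrt_pos.mpr (hpos k)), ?_, ?_⟩, fun j k => ?_⟩, fun k => ?_⟩
      · rw [Polynomial.natDegree_C_mul, h.natDegree_monicPoly]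
        exact Complex.ofReal_ne_zero.mpr (inv_pos.mpr (Real.sqrt_pos.mpr (hpos k))).ne'
      · rw [Polynomial.leadingCoeff_mul, Polynomial.leadingCoeff_C,
          (h.monic_monicPoly k).leadingCoeff, mul_one]
      · rw [ip_C_mul_right, ip_C_mul_left, Complex.conj_ofReal]
        split_ifs with hjk
        · subst hjk
          rw [← hreal, ← Complex.ofReal_mul, ← Complex.ofReal_mul, ← Complex.ofReal_one]
          congr 1
          have h2 := Real.mul_self_sqrt (hpos j).le
          have h3 := (Real.sqrt_pos.mpr (hpos j)).ne'
          beta_reduce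
          generalize √(ip (muCheck q lam eta ρ) (h.monicPoly j) (h.monicPoly j)).re = s at *
          rw [← h2]
          field_simp
        · rw [h.isMonicOPUC_monicPoly.2 j k hjk, mul_zero, mul_zero]
      · have h2 : ((√(ip (muCheck q lam eta ρ) (h.monicPoly k) (h.monicPoly k)).re)⁻¹ ^ (-2 : ℤ) :
            ℝ) = (ip (muCheck q lam eta ρ) (h.monicPoly k) (h.monicPoly k)).re := by
          rw [inv_zpow', neg_neg]
          exact_mod_cast Real.sq_sqrt (hpos k).le
        rw [h2, hreal, h.ip_self_monicPoly, hmass, one_mul, rpow_mul_cos hq0, hre,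
          normSq_cpow_bParam hq0, conj_cpow_bParam hq0]
        push_cast
        rfl
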